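/- **One-parameter dynamic item response (DIR) model.** For individuals $i=1,\dots,n$, test days $t=1,\dots,T_i$, tests $s=1,\dots,S_{i,t}$ and items $l=1,\dots,K_{i,t,s}$ let $X_{i,t,s,l}\in\{0,1\}$ be the observed responses. The quantities $a_{i,t,s}\in\mathbb{R}$, $\rho\neq 0$, $\sigma>0$, $\Delta_{i,t}>0$, $\Delta_{T_{\max}}>0$, $\mu_i\in\mathbb{R}$, $V_i>0$ are known; put $\Delta^+_{i,t}=\min\{\Delta_{i,t},\Delta_{T_{\max}}\}$. The model is $$\theta_{i,t}=\theta_{i,t-1}+c_i(1-\rho\,\theta_{i,t-1})\Delta^+_{i,t}+w_{i,t},\qquad w_{i,t}\sim\mathcal N(0,\phi^{-1}\Delta_{i,t}),$$ $$\Pr(X_{i,t,s,l}=1)=F(u_{i,t,s,l}),\qquad u_{i,t,s,l}=\theta_{i,t}-a_{i,t,s}+\varphi_{i,t}+\eta_{i,t,s}+\varepsilon_{i,t,s,l},\qquad F(u)=\frac{e^{u}}{1+e^{u}},$$ with $\varepsilon_{i,t,s,l}\sim\mathcal N(0,\sigma^2)$, $\varphi_{i,t}\sim\mathcal N(0,\delta_i^{-1})$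 and $(\eta_{i,t,1},\dots,\eta_{i,t,S_{i,t}})\sim\mathcal N(0,\tau_i^{-1}\mathbf I\mid\sum_s\eta_{i,t,s}=0)$, all independent given the parameters. The last vector is coordinatized by $\eta^*_{i,t}=(\eta_{i,t,1},\dots,\eta_{i,t,S_{i,t}-1})$, with $\eta_{i,t,S_{i,t}}=-\sum_{s<S_{i,t}}\eta_{i,t,s}$ and density proportional to $(\tau_i/2\pi)^{(S_{i,t}-1)/2}\exp(-\tau_i\,\eta^{*\prime}_{i,t}\Sigma_{i,t}^{-1}\eta^*_{i,t}/2)$, where $\Sigma_{i,t}^{-1}$ has diagonal entries $2$ and off-diagonal entries $1$. The priors are $\theta_{i,0}\sim\mathcal N(\mu_i,V_i)$, $\pi(c_i)\propto \mathbf 1\{c_i>0\}$, $\pi(\phi)=\phi^{-3/2}$, $\pi(\delta_i)=\delta_i^{-3/2}$, $\pi(\tau_i)=\tau_i^{-3/2}$ on $(0,\infty)$. The unnormalized joint posterior density of all unknowns $(\theta,c,\phi,\delta,\tau,\varphi,\eta^*,\varepsilon)$ is the product of these priors, of the above conditional densities of $\theta_{i,t}$ ($t\ge1$), $\varphi_{i,t}$,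 $\eta^*_{i,t}$, $\varepsilon_{i,t,s,l}$, and of the likelihood $\prod F(u_{i,t,s,l})^{X_{i,t,s,l}}(1-F(u_{i,t,s,l}))^{1-X_{i,t,s,l}}$. In its data-augmented form the unknowns $\varepsilon$ are replaced by latent variables $Y,\nu$, and the factors for $\varepsilon_{i,t,s,l}$ and $X_{i,t,s,l}$ are replaced by $$\pi(\nu_{i,t,s,l})\,\bigl(\mathbf 1\{Y_{i,t,s,l}>0,X_{i,t,s,l}=1\}+\mathbf 1\{Y_{i,t,s,l}\le0,X_{i,t,s,l}=0\}\bigr)\,f(Y_{i,t,s,l}),$$ where $f$ is the density of $\mathcal N(\theta_{i,t}-a_{i,t,s}+\varphi_{i,t}+\eta_{i,t,s},\,4\nu_{i,t,s,l}^2+\sigma^2)$ and $\pi(\nu)=8\sum_{\alpha\ge1}(-1)^{\alpha+1}\alpha^2\nu e^{-2\alpha^2\nu^2}$, $\nu\ge0$, is the Kolmogorov–Smirnov density. **Theorem (posterior propriety).** Assume $n\ge2$ and that for every individual $i$ one has $T_i\ge2$ and there are at least two distinct days $t\in\{1,\dots,T_i\}$ with $S_{i,t}\ge2$ on each of which at least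 two of the tests have at least one response $0$ and at least one response $1$. Then the joint posterior of the DIR model is proper, both in the original and in the data-augmented form: the unnormalized posterior density is nonnegative and Lebesgue integrable over the space of all unknowns, with strictly positive integral. -/

import Mathlib

open MeasureTheory

namespace DIR

noncomputable section

/-- The known quantities that belong to one individual: the number `T` of test days, the number
`S t` of tests on day `t`, the number `K t s` of items of each test, the ensemble mean
difficulties `a t s`, the time lapses `lapse t` between test day `t` and the preceding one,
the observed responses `X t s l` (`true` is the response 1, `false` is the response 0), and the
mean `mu` and variance `V` of the normal prior of the initial ability.
The test day with index `t : Fin T` is the day number `t + 1`. -/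
structure Individual where
  T : ℕ
  S : Fin T → ℕ
  K : (t : Fin T) → Fin (S t) → ℕ
  a : (t : Fin T) → Fin (S t) → ℝ
  lapse : Fin T → ℝ
  X : (t : Fin T) → (s : Fin (S t)) → Fin (K t s) → Bool
  mu : ℝ
  V : ℝ

/-- The known quantities shared by all individuals: the growth correction rate `rho`, the standard
deviation `sigma` of the item difficulty deviations, and the maximal time lapse `maxLapse`. -/
structure Constants where
  rho : ℝ
  sigma : ℝ
  maxLapse : ℝ

/-- The density of the normal distribution with mean `m` and variance `v`, at `x`. -/
def normalDensity (m v x : ℝ) : ℝ := ProbabilityTheory.gaussianPDFReal m v.toNNReal x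

/-- The improper prior `1{c > 0}` of a growth rate. -/
def growthPrior (c : ℝ) : ℝ := if 0 < c then 1 else 0

/-- The improper prior `x ^ (-3/2)` on `x > 0` of a precision parameter. -/
def precisionPrior (x : ℝ) : ℝ := if 0 < x then x ^ (-(3 / 2) : ℝ) else 0

/-- The matrix with diagonal entries 2 and off-diagonal entries 1. -/
def sigmaInv (m : ℕ) : Matrix (Fin m) (Fin m) ℝ := Matrix.of fun j k => if j = k then 2 else 1

/-- The density, up to a constant factor, of the first `m` coordinates of a centred normal vector
in dimension `m + 1` with covariance `tau⁻¹ I` conditioned to have coordinate sum zero. -/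
def testEffectDensity {m : ℕ} (tau : ℝ) (etaStar : Fin m → ℝ) : ℝ :=
  (tau / (2 * Real.pi)) ^ ((m : ℝ) / 2) *
    Real.exp (-(tau * (etaStar ⬝ᵥ (sigmaInv m).mulVec etaStar)) / 2)

/-- All `S` test effects of a day, from the first `S - 1` ones: the last is minus their sum. -/
def testEffect {S : ℕ} (etaStar : Fin (S - 1) → ℝ) (s : Fin S) : ℝ :=
  if h : (s : ℕ) < S - 1 then etaStar ⟨s, h⟩ else -∑ j, etaStar j

/-- The Kolmogorov--Smirnov density
`8 ∑_{α ≥ 1} (-1)^(α+1) α² ν exp (-2 α² ν²)` on `ν ≥ 0` (the index `k` below is `α - 1`). -/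
def ksDensity (nu : ℝ) : ℝ :=
  if 0 ≤ nu then
    8 * ∑' k : ℕ, (-1 : ℝ) ^ (k + 2) * ((k : ℝ) + 1) ^ 2 * nu *
      Real.exp (-(2 * ((k : ℝ) + 1) ^ 2 * nu ^ 2))
  else 0

/-- The unknowns of one individual common to both forms of the model:
the abilities `θ_0, …, θ_T`, the growth rate `c`, the precisions `δ` and `τ`,
the daily effects, and the first `S t - 1` test effects of each day. -/
abbrev BaseParams (I : Individual) : Type :=
  (Fin (I.T + 1) → ℝ) × ℝ × ℝ × ℝ × (Fin I.T → ℝ) × ((t : Fin I.T) → Fin (I.S t - 1) → ℝ)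

/-- A family of real numbers indexed by all the items presented to one individual. -/
abbrev ItemFamily (I : Individual) : Type :=
  (t : Fin I.T) → (s : Fin (I.S t)) → Fin (I.K t s) → ℝ

/-- The truncated time lapse. -/
def truncLapse (C : Constants) (I : Individual) (t : Fin I.T) : ℝ := min (I.lapse t) C.maxLapse

/-- `θ_t - a_{t,s} + φ_t + η_{t,s}`. -/
def predictor (I : Individual) (p : BaseParams I) (t : Fin I.T) (s : Fin (I.S t)) : ℝ :=
  match p with
  | (theta, _, _, _, day, etaStar) =>
    theta t.succ - I.a t s + day t + testEffect (etaStar t) s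

/-- The priors of one individual's parameters times the conditional densities of the abilities,
daily effects and test effects, given the system precision `phi`. -/
def baseDensity (C : Constants) (I : Individual) (phi : ℝ) (p : BaseParams I) : ℝ :=
  match p with
  | (theta, c, delta, tau, day, etaStar) =>
    normalDensity I.mu I.V (theta 0) * growthPrior c * precisionPrior delta * precisionPrior tau *
    (∏ t : Fin I.T, normalDensity
      (theta t.castSucc + c * (1 - C.rho * theta t.castSucc) * truncLapse C I t)
      (I.lapse t / phi) (theta t.succ)) *
    (∏ t : Fin I.T, normalDensity 0 (1 / delta) (day t)) *
    (∏ t : Fin I.T, testEffectDensity tau (etaStar t))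

/-- The probability of the response `x` when the logit of response 1 is `u`. -/
def responseProb (x : Bool) (u : ℝ) : ℝ :=
  if x = true then Real.exp u / (1 + Real.exp u) else 1 - Real.exp u / (1 + Real.exp u)

/-- The unknowns of the model: the system precision `φ`, and for each individual the base
parameters and the item difficulty deviations `ε`. -/
abbrev Params {n : ℕ} (I : Fin n → Individual) : Type :=
  ℝ × ((i : Fin n) → BaseParams (I i) × ItemFamily (I i))

/-- The unnormalized joint posterior density of the one-parameter DIR model. -/
def posterior {n : ℕ} (C : Constants) (I : Fin n → Individual) (w : Params I) : ℝ :=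
  precisionPrior w.1 *
  ∏ i, (baseDensity C (I i) w.1 (w.2 i).1 *
    ∏ t, ∏ s, ∏ l,
      (normalDensity 0 (C.sigma ^ 2) ((w.2 i).2 t s l) *
        responseProb ((I i).X t s l) (predictor (I i) (w.2 i).1 t s + (w.2 i).2 t s l)))

/-- The unknowns of the model with data augmentation: the system precision `φ`, and for each
individual the base parameters and the latent variables `Y` and `ν`. -/
abbrev AugParams {n : ℕ} (I : Fin n → Individual) : Type :=
  ℝ × ((i : Fin n) → BaseParams (I i) × ItemFamily (I i) × ItemFamily (I i))

/-- The indicator that the response `x` is 1 and `y > 0`, or that it is 0 and `y ≤ 0`. -/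
def signIndicator (x : Bool) (y : ℝ) : ℝ :=
  if (x = true ∧ 0 < y) ∨ (x = false ∧ y ≤ 0) then 1 else 0

/-- The unnormalized joint posterior density of the one-parameter DIR model in its data-augmented
form, in which the item difficulty deviations are integrated out. -/
def augPosterior {n : ℕ} (C : Constants) (I : Fin n → Individual) (w : AugParams I) : ℝ :=
  precisionPrior w.1 *
  ∏ i, (baseDensity C (I i) w.1 (w.2 i).1 *
    ∏ t, ∏ s, ∏ l,
      (ksDensity ((w.2 i).2.2 t s l) * signIndicator ((I i).X t s l) ((w.2 i).2.1 t s l) *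
        normalDensity (predictor (I i) (w.2 i).1 t s)
          (4 * (w.2 i).2.2 t s l ^ 2 + C.sigma ^ 2) ((w.2 i).2.1 t s l)))

/-- An unnormalized density with respect to Lebesgue measure is proper if it is nonnegative and
integrable with positive integral, so that it can be normalized to a probability density. -/
def IsProper {Ω : Type*} [MeasureSpace Ω] (f : Ω → ℝ) : Prop :=
  (∀ w, 0 ≤ f w) ∧ Integrable f ∧ 0 < ∫ w, f w

/-- The test `s` on day `t` has at least one 0 and at least one 1 response. -/
def Individual.MixedTest (I : Individual) (t : Fin I.T) (s : Fin (I.S t)) : Prop :=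
  (∃ l, I.X t s l = false) ∧ ∃ l, I.X t s l = true

/-- On day `t` there are at least two tests, and at least two of the tests are mixed. -/
def Individual.InformativeDay (I : Individual) (t : Fin I.T) : Prop :=
  2 ≤ I.S t ∧ ∃ s s', s ≠ s' ∧ I.MixedTest t s ∧ I.MixedTest t s'

end

end DIR

namespace DIR

open ENNReal

/-! ### Integrals over finite products -/

/-! All factors are nonnegative, so by Tonelli propriety reduces to a finite iterated integral plus
positivity on a nonempty open set. The improper priors set the targets: `x ^ (-3/2)` becomes
integrable after multiplication by `min 1 √x ^ r`, and `1{c > 0}` after multiplication by `(1 + c)⁻¹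
^ r`, in each case with `r > 1`.

Integrating out the item variables leaves response probabilities that decay like `exp (-|v| / 2)` on
the unfavourable side of the predictor `v`, in both forms of the model (`ResponseBound`). A mixed
test therefore decays on both sides. Two mixed tests on one day control the difference of their test
effects, which is free of ability and daily effect and yields a factor `min 1 √τ`, and also localize
ability plus daily effect. Two informative days give `min 1 √τ ^ 2`.

Localization on one informative day yields `min 1 √δ` by integrating its daily effect. On the other
day `k`, chosen not to be the first test day, the ability expectation `E` of the smoothed bound
admits three estimates, up to constants: `min 1 √δ`, `min 1 √φ * (1 + c)⁻¹` and `(1 + c)⁻¹ ^ 2`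
(`exists_abilityMean_le`). The last two hold because the transition mean is affine in the previous
ability with slope `1 - c ρ Δ⁺`, so each transition contracts Lebesgue mass by a factor of order `1
/ c` for large `c`, and at least two transitions precede day `k`. The geometric mean with weights
1/8, 5/8, 1/4 gives exponents 1 + 1/8 for `δ`, 5/8 + 2/4 = 9/8 for `c`, and 5/8 for `φ`. The
precision `φ` is shared, so `n ≥ 2` individuals give exponent at least 5/4, again above 1.

The augmented form also needs the Kolmogorov–Smirnov density to be nonnegative and `exp (ν ^ 2 / 2)`
to be integrable against it. Jacobi's theta transformation settles small `ν`, the alternating series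
large `ν`. -/

theorem lintegral_pi_insertNth {n : ℕ} {E : Fin (n + 1) → Type*} [∀ i, MeasureSpace (E i)]
    [∀ i, SigmaFinite (volume : Measure (E i))] (i : Fin (n + 1)) {f : (∀ j, E j) → ℝ≥0∞}
    (hf : Measurable f) :
    ∫⁻ w, f w = ∫⁻ x : E i, ∫⁻ y : (∀ j : Fin n, E (i.succAbove j)), f (i.insertNth x y) := by
  have h := (volume_preserving_piFinSuccAbove E i).symm
  rw [← h.lintegral_comp_emb (MeasurableEquiv.measurableEmbedding _), Measure.volume_eq_prod,
    lintegral_prod _ (Measurable.aemeasurable (by fun_prop))]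
  rfl

theorem lintegral_pi_insertNth_symm {n : ℕ} {E : Fin (n + 1) → Type*} [∀ i, MeasureSpace (E i)]
    [∀ i, SigmaFinite (volume : Measure (E i))] (i : Fin (n + 1)) {f : (∀ j, E j) → ℝ≥0∞}
    (hf : Measurable f) :
    ∫⁻ w, f w = ∫⁻ y : (∀ j : Fin n, E (i.succAbove j)), ∫⁻ x : E i, f (i.insertNth x y) := by
  have h := (volume_preserving_piFinSuccAbove E i).symm
  rw [← h.lintegral_comp_emb (MeasurableEquiv.measurableEmbedding _), Measure.volume_eq_prod,
    lintegral_prod_symm _ (Measurable.aemeasurable (by fun_prop))]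
  rfl

theorem lintegral_fin_prod {n : ℕ} {E : Fin n → Type*} [∀ i, MeasureSpace (E i)]
    [∀ i, SigmaFinite (volume : Measure (E i))] {f : ∀ i, E i → ℝ≥0∞}
    (hf : ∀ i, Measurable (f i)) :
    ∫⁻ w : (∀ i, E i), ∏ i, f i (w i) = ∏ i, ∫⁻ x, f i x := by
  induction n with
  | zero =>
    simp only [Finset.univ_eq_empty, Finset.prod_empty, lintegral_one]
    rw [← Set.pi_univ Set.univ, volume_pi, Measure.pi_pi]
    simp
  | succ n ih =>
    rw [lintegral_pi_insertNth 0 (by fun_prop)]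
    simp only [Fin.prod_univ_succ, Fin.insertNth_apply_same]
    have : ∀ x : E 0, ∫⁻ y : (∀ j : Fin n, E (Fin.succAbove 0 j)), f 0 x *
        ∏ i : Fin n, f i.succ ((Fin.insertNth (α := E) 0 x y) i.succ) =
        f 0 x * ∏ i : Fin n, ∫⁻ x, f i.succ x := by
      intro x
      rw [← ih (E := fun j : Fin n => E j.succ) (fun i => hf i.succ)]
      rw [← lintegral_const_mul _ (by fun_prop)]
      rfl
    simp only [this]
    rw [lintegral_mul_const _ (hf 0)]

/-! ### Normal densities -/

theorem normalDensity_nonneg (m v x : ℝ) : 0 ≤ normalDensity m v x :=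
  ProbabilityTheory.gaussianPDFReal_nonneg _ _ _

theorem normalDensity_pos {v : ℝ} (hv : 0 < v) (m x : ℝ) : 0 < normalDensity m v x :=
  ProbabilityTheory.gaussianPDFReal_pos _ _ _ (by simpa using hv)

theorem measurable_normalDensity :
    Measurable fun q : ℝ × ℝ × ℝ => normalDensity q.1 q.2.1 q.2.2 := by
  unfold normalDensity
  exact ProbabilityTheory.measurable_uncurry_gaussianPDFReal.comp
    (f := fun q : ℝ × ℝ × ℝ => (q.1, q.2.1.toNNReal, q.2.2)) (by fun_prop)

@[fun_prop]
theorem _root_.Measurable.normalDensity {α : Type*} [MeasurableSpace α] {m v x : α → ℝ}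
    (hm : Measurable m) (hv : Measurable v) (hx : Measurable x) :
    Measurable fun a => normalDensity (m a) (v a) (x a) :=
  measurable_normalDensity.comp (hm.prodMk (hv.prodMk hx))

theorem normalDensity_eq {v : ℝ} (hv : 0 ≤ v) (m x : ℝ) : normalDensity m v x =
    (√(2 * Real.pi * v))⁻¹ * Real.exp (-(x - m) ^ 2 / (2 * v)) := by
  simp [normalDensity, ProbabilityTheory.gaussianPDFReal_def, Real.coe_toNNReal v hv]

theorem normalDensity_comm (m v x : ℝ) : normalDensity m v x = normalDensity x v m := by
  simp only [normalDensity, ProbabilityTheory.gaussianPDFReal_def]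
  rw [← neg_sq (x - m), neg_sub]

theorem lintegral_normalDensity {v : ℝ} (hv : 0 < v) (m : ℝ) :
    ∫⁻ x, .ofReal (normalDensity m v x) = 1 :=
  ProbabilityTheory.lintegral_gaussianPDFReal_eq_one m (by simpa using hv)

theorem lintegral_normalDensity_le_one (m v : ℝ) :
    ∫⁻ x, .ofReal (normalDensity m v x) ≤ 1 := by
  rcases lt_or_ge 0 v with hv | hv
  · rw [lintegral_normalDensity hv]
  -- A nonpositive variance is truncated to 0, where the density is identically 0.
  · simp [normalDensity, Real.toNNReal_of_nonpos hv]

theorem normalDensity_le {v : ℝ} (hv : 0 ≤ v) (m x : ℝ) : normalDensity m v x ≤ (√v)⁻¹ := by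
  rw [normalDensity_eq hv]
  rcases hv.eq_or_lt with rfl | hv
  · simp
  · have h1 : Real.exp (-(x - m) ^ 2 / (2 * v)) ≤ 1 := by
      rw [Real.exp_le_one_iff]
      apply div_nonpos_of_nonpos_of_nonneg <;> nlinarith [sq_nonneg (x - m)]
    have h2 : √v ≤ √(2 * Real.pi * v) := Real.sqrt_le_sqrt (by nlinarith [Real.pi_gt_three])
    have h3 : 0 < √v := Real.sqrt_pos.2 hv
    calc _ ≤ (√(2 * Real.pi * v))⁻¹ * 1 := by gcongr
      _ ≤ _ := by rw [mul_one]; gcongr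

theorem lintegral_comp_affine {a : ℝ} (ha : a ≠ 0) (b : ℝ) {f : ℝ → ℝ≥0∞} (hf : Measurable f) :
    ∫⁻ x, f (a * x + b) = .ofReal |a|⁻¹ * ∫⁻ x, f x := by
  have h1 : ∫⁻ x, f (a * x + b) = ∫⁻ x, f (x + b) ∂(Measure.map (fun x => a * x) volume) := by
    rw [lintegral_map (by fun_prop) (by fun_prop)]
  rw [h1, Real.map_volume_mul_left ha, lintegral_smul_measure, lintegral_add_right_eq_self, abs_inv,
    smul_eq_mul]

/-- The integral of a function against a normal density is at most `σ⁻¹` times its integral. -/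
theorem lintegral_normalDensity_mul_le {v : ℝ} (hv : 0 ≤ v) (m : ℝ) {f : ℝ → ℝ≥0∞}
    (hf : Measurable f) :
    ∫⁻ x, .ofReal (normalDensity m v x) * f x ≤ .ofReal (√v)⁻¹ * ∫⁻ x, f x := by
  rw [← lintegral_const_mul _ hf]
  gcongr
  exact normalDensity_le hv _ _

theorem lintegral_normalDensity_mul_le_sup (m v : ℝ) {f : ℝ → ℝ≥0∞} {M : ℝ≥0∞}
    (hM : ∀ x, f x ≤ M) :
    ∫⁻ x, .ofReal (normalDensity m v x) * f x ≤ M := by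
  calc _ ≤ ∫⁻ x, .ofReal (normalDensity m v x) * M := by gcongr; exact hM _
    _ = (∫⁻ x, .ofReal (normalDensity m v x)) * M := lintegral_mul_const _ (by fun_prop)
    _ ≤ 1 * M := by gcongr; exact lintegral_normalDensity_le_one _ _
    _ = M := one_mul _

theorem lintegral_exp_neg_abs {b : ℝ} (hb : 0 < b) :
    ∫⁻ x : ℝ, .ofReal (Real.exp (-(b * |x|))) = .ofReal (2 / b) := by
  have h1 := integral_exp_mul_Ioi (a := -b) (by linarith) 0
  have h3 : ∫ x : ℝ, Real.exp (-(b * |x|)) = 2 / b := by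
    rw [integral_comp_abs (f := fun x => Real.exp (-(b * x)))]
    simp only [neg_mul] at h1
    rw [h1, mul_zero, neg_zero, Real.exp_zero]
    field_simp
  rw [← ofReal_integral_eq_lintegral_ofReal, h3]
  · exact .of_integral_ne_zero (by rw [h3]; positivity)
  · exact Filter.Eventually.of_forall fun x => (Real.exp_pos _).le

/-! ### The prior of a precision -/

theorem precisionPrior_nonneg (x : ℝ) : 0 ≤ precisionPrior x := by
  unfold precisionPrior; split_ifs with h
  · positivity
  · rfl

@[fun_prop]
theorem measurable_precisionPrior : Measurable precisionPrior := by
  unfold precisionPrior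
  exact Measurable.ite measurableSet_Ioi (by fun_prop) (by fun_prop)

theorem growthPrior_nonneg (x : ℝ) : 0 ≤ growthPrior x := by
  unfold growthPrior; split_ifs <;> simp

@[fun_prop]
theorem measurable_growthPrior : Measurable growthPrior := by
  unfold growthPrior
  exact Measurable.ite measurableSet_Ioi (by fun_prop) (by fun_prop)

/-- On `(0, 1]` the integrand is `x ^ ((r - 3) / 2)`, integrable at 0 exactly because `r > 1`;
beyond 1 it is `x ^ (-3/2)`. -/
theorem lintegral_precisionPrior_lt_top {r : ℝ} (hr : 1 < r) :
    ∫⁻ x, .ofReal (precisionPrior x) * .ofReal (min 1 √x) ^ r < ∞ := by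
  have key : ∀ x, ENNReal.ofReal (precisionPrior x) * .ofReal (min 1 √x) ^ r ≤
      (Set.Ioc 0 1).indicator (fun x : ℝ => .ofReal (x ^ (r / 2 - 3 / 2))) x +
      (Set.Ioi 1).indicator (fun x : ℝ => .ofReal (x ^ (-(3 / 2) : ℝ))) x := by
    intro x
    by_cases h0 : 0 < x
    · rw [ENNReal.ofReal_rpow_of_nonneg (by positivity) (by linarith),
        ← ENNReal.ofReal_mul (precisionPrior_nonneg _), precisionPrior, if_pos h0]
      rcases le_or_gt x 1 with h | h
      · rw [Set.indicator_of_mem (s := Set.Ioc 0 1) ⟨h0, h⟩]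
        refine le_add_right (ENNReal.ofReal_le_ofReal ?_)
        rw [min_eq_right (by rwa [Real.sqrt_le_one]), Real.sqrt_eq_rpow, ← Real.rpow_mul h0.le,
          ← Real.rpow_add h0]
        ring_nf; rfl
      · rw [Set.indicator_of_mem (s := Set.Ioi 1) h]
        refine le_add_left (ENNReal.ofReal_le_ofReal ?_)
        rw [min_eq_left (by rw [Real.one_le_sqrt]; exact h.le)]
        simp
    · simp [precisionPrior, h0]
  refine (lintegral_mono key).trans_lt ?_
  rw [lintegral_add_left (by measurability), lintegral_indicator measurableSet_Ioc,
    lintegral_indicator measurableSet_Ioi, ENNReal.add_lt_top]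
  constructor
  · refine IntegrableOn.setLIntegral_lt_top ?_
    rw [← intervalIntegrable_iff_integrableOn_Ioc_of_le zero_le_one]
    exact intervalIntegral.intervalIntegrable_rpow' (by linarith)
  · refine IntegrableOn.setLIntegral_lt_top ?_
    exact integrableOn_Ioi_rpow_of_lt (by norm_num) one_pos

theorem lintegral_growthPrior_lt_top {r : ℝ} (hr : 1 < r) :
    ∫⁻ c, .ofReal (growthPrior c) * .ofReal (1 + c)⁻¹ ^ r < ∞ := by
  have key : ∀ x, ENNReal.ofReal (growthPrior x) * .ofReal (1 + x)⁻¹ ^ r ≤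
      (Set.Ioi 1).indicator (fun x : ℝ => .ofReal (x ^ (-r))) (x + 1) := by
    intro x
    by_cases h0 : 0 < x
    · rw [Set.indicator_of_mem (by simpa using h0), ENNReal.ofReal_rpow_of_nonneg
        (by positivity) (by linarith), growthPrior, if_pos h0, Real.inv_rpow (by positivity),
        Real.rpow_neg (by positivity), add_comm]
      simp
    · simp [growthPrior, h0]
  refine (lintegral_mono key).trans_lt ?_
  rw [lintegral_add_right_eq_self, lintegral_indicator measurableSet_Ioi]
  exact IntegrableOn.setLIntegral_lt_top (integrableOn_Ioi_rpow_of_lt (by linarith) one_pos)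

/-! ### Markov chains with densities -/

/-- The product of the transition densities `p t` along the path `x, θ 0, θ 1, …`. -/
noncomputable def pathDensity {T : ℕ} (p : Fin T → ℝ → ℝ → ℝ≥0∞) (x : ℝ) (θ : Fin T → ℝ) : ℝ≥0∞ :=
  ∏ t, p t (Fin.cons (α := fun _ => ℝ) x θ t.castSucc) (θ t)

theorem pathDensity_cons {T : ℕ} (p : Fin (T + 1) → ℝ → ℝ → ℝ≥0∞) (x y : ℝ) (θ : Fin T → ℝ) :
    pathDensity p x (Fin.cons (α := fun _ => ℝ) y θ) =
      p 0 x y * pathDensity (fun t => p t.succ) y θ := by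
  simp only [pathDensity, Fin.prod_univ_succ, Fin.castSucc_zero, Fin.cons_zero, Fin.cons_succ,
    Fin.castSucc_succ]

@[fun_prop]
theorem measurable_pathDensity {T : ℕ} {p : Fin T → ℝ → ℝ → ℝ≥0∞}
    (hp : ∀ t, Measurable fun z : ℝ × ℝ => p t z.1 z.2) :
    Measurable fun z : ℝ × (Fin T → ℝ) => pathDensity p z.1 z.2 := by
  have h : ∀ s : Fin (T + 1), Measurable fun z : ℝ × (Fin T → ℝ) =>
      (Fin.cons z.1 z.2 : Fin (T + 1) → ℝ) s := by
    intro s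
    refine Fin.cases ?_ (fun j => ?_) s
    · simpa only [Fin.cons_zero] using measurable_fst
    · simp only [Fin.cons_succ]; fun_prop
  unfold pathDensity
  exact Finset.measurable_fun_prod _ fun t _ => (hp t).comp
    (f := fun z : ℝ × (Fin T → ℝ) => ((Fin.cons z.1 z.2 : Fin (T + 1) → ℝ) t.castSucc, z.2 t))
    ((h _).prodMk (by fun_prop))

theorem measurable_pathDensity_right {T : ℕ} {p : Fin T → ℝ → ℝ → ℝ≥0∞}
    (hp : ∀ t, Measurable fun z : ℝ × ℝ => p t z.1 z.2) (x : ℝ) : Measurable (pathDensity p x) :=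
  (measurable_pathDensity hp).comp (measurable_const.prodMk measurable_id)

/-- Conditioning on the first transition; this recursion drives all the inductions on the length of
the chain. -/
theorem lintegral_pathDensity_mul_succ {T : ℕ} {p : Fin (T + 1) → ℝ → ℝ → ℝ≥0∞}
    (hp : ∀ t, Measurable fun z : ℝ × ℝ => p t z.1 z.2) (x : ℝ) {F : (Fin (T + 1) → ℝ) → ℝ≥0∞}
    (hF : Measurable F) :
    ∫⁻ θ, pathDensity p x θ * F θ = ∫⁻ y, p 0 x y *
      ∫⁻ θ : Fin T → ℝ, pathDensity (fun t => p t.succ) y θ *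
        F (Fin.cons (α := fun _ => ℝ) y θ) := by
  have h1 : Measurable (pathDensity p x) :=
    measurable_pathDensity_right hp x
  rw [lintegral_pi_insertNth 0 (by fun_prop)]
  congr 1; ext y
  have h2 : Measurable (pathDensity (fun t => p t.succ) y) :=
    measurable_pathDensity_right (fun t => hp t.succ) y
  have h3 : Measurable fun θ : Fin T → ℝ => (Fin.cons (α := fun _ => ℝ) y θ) := by
    refine measurable_pi_lambda _ fun t => ?_
    refine Fin.cases ?_ (fun j => ?_) t <;> simp only [Fin.cons_zero, Fin.cons_succ] <;> fun_prop
  have h4 : Measurable fun θ => pathDensity (fun t => p t.succ) y θ *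
    F (Fin.cons (α := fun _ => ℝ) y θ) := h2.mul (hF.comp h3)
  rw [← lintegral_const_mul _ h4]
  congr 1; ext θ
  simp only [Fin.insertNth_zero]
  rw [← mul_assoc, ← pathDensity_cons]
  rfl

theorem lintegral_pathDensity_le_one {T : ℕ} {p : Fin T → ℝ → ℝ → ℝ≥0∞}
    (hp : ∀ t, Measurable fun z : ℝ × ℝ => p t z.1 z.2) (h1 : ∀ t x, ∫⁻ y, p t x y ≤ 1) (x : ℝ) :
    ∫⁻ θ, pathDensity p x θ ≤ 1 := by
  induction T generalizing x with
  | zero =>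
    simp only [pathDensity, Finset.univ_eq_empty, Finset.prod_empty, lintegral_one]
    rw [← Set.pi_univ Set.univ, volume_pi, Measure.pi_pi]
    simp
  | succ T ih =>
    have h := lintegral_pathDensity_mul_succ hp x (F := fun _ => 1) measurable_const
    simp only [mul_one] at h
    rw [h]
    calc _ ≤ ∫⁻ y, p 0 x y * 1 := by
          gcongr with y
          exact ih (fun t => hp t.succ) (fun t => h1 t.succ) y
      _ ≤ 1 := by simpa using h1 0 x

/-- The expectation of `f` of the state after `k + 1` transitions, starting from `x`. -/
noncomputable def chainMean {T : ℕ} (p : Fin T → ℝ → ℝ → ℝ≥0∞) (k : Fin T) (f : ℝ → ℝ≥0∞)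
    (x : ℝ) : ℝ≥0∞ :=
  ∫⁻ θ, pathDensity p x θ * f (θ k)

section chain

variable {T : ℕ} {f : ℝ → ℝ≥0∞}

theorem measurable_chainMean {p : Fin T → ℝ → ℝ → ℝ≥0∞}
    (hp : ∀ t, Measurable fun z : ℝ × ℝ => p t z.1 z.2) (hf : Measurable f) (k : Fin T) :
    Measurable (chainMean p k f) := by
  unfold chainMean
  exact Measurable.lintegral_prod_right' (f := fun z : ℝ × (Fin T → ℝ) =>
    pathDensity p z.1 z.2 * f (z.2 k)) ((measurable_pathDensity hp).mul (by fun_prop))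

theorem chainMean_zero_le {p : Fin (T + 1) → ℝ → ℝ → ℝ≥0∞}
    (hp : ∀ t, Measurable fun z : ℝ × ℝ => p t z.1 z.2) (h1 : ∀ t x, ∫⁻ y, p t x y ≤ 1)
    (hf : Measurable f) (x : ℝ) : chainMean p 0 f x ≤ ∫⁻ y, p 0 x y * f y := by
  unfold chainMean
  rw [lintegral_pathDensity_mul_succ hp x (F := fun θ => f (θ 0)) (by fun_prop)]
  gcongr with y
  simp only [Fin.cons_zero]
  have h2 : Measurable (pathDensity (fun t => p t.succ) y) :=
    measurable_pathDensity_right (fun t => hp t.succ) y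
  rw [lintegral_mul_const _ h2]
  exact mul_le_of_le_one_left' (lintegral_pathDensity_le_one (fun t => hp t.succ)
    (fun t => h1 t.succ) y)

theorem chainMean_succ {p : Fin (T + 1) → ℝ → ℝ → ℝ≥0∞}
    (hp : ∀ t, Measurable fun z : ℝ × ℝ => p t z.1 z.2)
    (hf : Measurable f) (k : Fin T) (x : ℝ) :
    chainMean p k.succ f x = ∫⁻ y, p 0 x y * chainMean (fun t => p t.succ) k f y := by
  unfold chainMean
  rw [lintegral_pathDensity_mul_succ hp x (F := fun θ => f (θ k.succ)) (by fun_prop)]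
  simp only [Fin.cons_succ]

theorem chainMean_le_sup {p : Fin T → ℝ → ℝ → ℝ≥0∞}
    (hp : ∀ t, Measurable fun z : ℝ × ℝ => p t z.1 z.2) (h1 : ∀ t x, ∫⁻ y, p t x y ≤ 1)
    {M : ℝ≥0∞} (hM : ∀ x, f x ≤ M) (k : Fin T) (x : ℝ) : chainMean p k f x ≤ M := by
  have h2 : Measurable (pathDensity p x) :=
    measurable_pathDensity_right hp x
  calc chainMean p k f x ≤ ∫⁻ θ, pathDensity p x θ * M := by
        unfold chainMean; gcongr; exact hM _
    _ = (∫⁻ θ, pathDensity p x θ) * M := lintegral_mul_const _ h2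
    _ ≤ M := mul_le_of_le_one_left' (lintegral_pathDensity_le_one hp h1 x)

/-- The transition into the observed state has density at most `s`; earlier and later transitions
have total mass at most 1. -/
theorem chainMean_le_of_le {p : Fin T → ℝ → ℝ → ℝ≥0∞}
    (hp : ∀ t, Measurable fun z : ℝ × ℝ => p t z.1 z.2) (h1 : ∀ t x, ∫⁻ y, p t x y ≤ 1)
    (hf : Measurable f) {s : ℝ≥0∞} (hs : ∀ t x y, p t x y ≤ s) (k : Fin T) (x : ℝ) :
    chainMean p k f x ≤ s * ∫⁻ y, f y := by
  induction T generalizing x with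
  | zero => exact k.elim0
  | succ T ih =>
    refine Fin.cases ?_ (fun k => ?_) k
    · refine (chainMean_zero_le hp h1 hf x).trans ?_
      rw [← lintegral_const_mul _ hf]
      gcongr
      exact hs _ _ _
    · rw [chainMean_succ hp hf]
      calc _ ≤ ∫⁻ y, p 0 x y * (s * ∫⁻ y, f y) := by
            gcongr with y
            exact ih (fun t => hp t.succ) (fun t => h1 t.succ) (fun t => hs t.succ) k y
        _ = (∫⁻ y, p 0 x y) * (s * ∫⁻ y, f y) :=
            lintegral_mul_const _ ((hp 0).comp (measurable_const.prodMk measurable_id))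
        _ ≤ _ := mul_le_of_le_one_left' (h1 0 x)

/-- Here the starting point is integrated against Lebesgue measure. By Tonelli, each of the `k + 1`
transitions up to the observed state then costs a factor `q`. -/
theorem lintegral_chainMean_le {p : Fin T → ℝ → ℝ → ℝ≥0∞}
    (hp : ∀ t, Measurable fun z : ℝ × ℝ => p t z.1 z.2) (h1 : ∀ t x, ∫⁻ y, p t x y ≤ 1)
    (hf : Measurable f) {q : ℝ≥0∞} (hq : ∀ t y, ∫⁻ x, p t x y ≤ q) (k : Fin T) :
    ∫⁻ x, chainMean p k f x ≤ q ^ (k + 1 : ℕ) * ∫⁻ y, f y := by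
  induction T with
  | zero => exact k.elim0
  | succ T ih =>
    have key : ∀ g : ℝ → ℝ≥0∞, Measurable g →
        ∫⁻ x, ∫⁻ y, p 0 x y * g y ≤ q * ∫⁻ y, g y := by
      intro g hg
      rw [lintegral_lintegral_swap
        ((hp 0).mul (hg.comp measurable_snd)).aemeasurable, ← lintegral_const_mul _ hg]
      gcongr with y
      have h2 : Measurable fun x => p 0 x y := (hp 0).comp (measurable_id.prodMk measurable_const)
      rw [lintegral_mul_const _ h2]
      gcongr
      exact hq 0 y
    refine Fin.cases ?_ (fun k => ?_) k
    · calc _ ≤ ∫⁻ x, ∫⁻ y, p 0 x y * f y := by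
            gcongr with x
            exact chainMean_zero_le hp h1 hf x
        _ ≤ _ := by simpa using key f hf
    · simp only [chainMean_succ hp hf]
      refine (key _ (measurable_chainMean (fun t => hp t.succ) hf k)).trans ?_
      calc _ ≤ q * (q ^ (k + 1 : ℕ) * ∫⁻ y, f y) := by
            gcongr
            exact ih (fun t => hp t.succ) (fun t => h1 t.succ) (fun t => hq t.succ) k
        _ = _ := by rw [Fin.val_succ, pow_succ' q (k + 1 : ℕ), mul_assoc]

/-- Bounding the first transition density by `s` turns the law of its endpoint into Lebesgue
measure, and the remaining transitions contract. At least one remains because `1 ≤ k`, and surplus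
powers of `q ≤ 1` are dropped. -/
theorem chainMean_le_of_le_of_lintegral_le {p : Fin T → ℝ → ℝ → ℝ≥0∞}
    (hp : ∀ t, Measurable fun z : ℝ × ℝ => p t z.1 z.2) (h1 : ∀ t x, ∫⁻ y, p t x y ≤ 1)
    (hf : Measurable f) {s q : ℝ≥0∞} (hs : ∀ t x y, p t x y ≤ s) (hq1 : q ≤ 1)
    (hq : ∀ t y, ∫⁻ x, p t x y ≤ q) (k : Fin T) (hk : 1 ≤ (k : ℕ)) (x : ℝ) :
    chainMean p k f x ≤ s * (q * ∫⁻ y, f y) := by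
  cases T with
  | zero => exact k.elim0
  | succ T =>
    obtain ⟨j, rfl⟩ : ∃ j : Fin T, k = j.succ := Fin.exists_succ_eq.2 (by
      rintro rfl; simp at hk) |>.imp fun _ h => h.symm
    rw [chainMean_succ hp hf]
    have hm := measurable_chainMean (fun t => hp t.succ) hf j
    calc _ ≤ ∫⁻ y, s * chainMean (fun t => p t.succ) j f y := by gcongr; exact hs _ _ _
      _ = s * ∫⁻ y, chainMean (fun t => p t.succ) j f y := lintegral_const_mul _ hm
      _ ≤ s * (q ^ (j + 1 : ℕ) * ∫⁻ y, f y) := by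
        gcongr
        exact lintegral_chainMean_le (fun t => hp t.succ) (fun t => h1 t.succ) hf
          (fun t => hq t.succ) j
      _ ≤ _ := by 
        gcongr
        exact (pow_le_pow_right_of_le_one' hq1 (show 1 ≤ (j + 1 : ℕ) by omega)).trans_eq (pow_one q)

end chain

/-! ### The chain of abilities -/

/-- The conditional density of the next ability. -/
noncomputable def abilityKernel (C : Constants) (I : Individual) (phi c : ℝ) (t : Fin I.T)
    (x y : ℝ) : ℝ≥0∞ :=
  .ofReal (normalDensity (x + c * (1 - C.rho * x) * truncLapse C I t) (I.lapse t / phi) y)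

theorem measurable_abilityKernel (C : Constants) (I : Individual) (phi c : ℝ) (t : Fin I.T) :
    Measurable fun z : ℝ × ℝ => abilityKernel C I phi c t z.1 z.2 := by
  unfold abilityKernel; fun_prop

/-- The normal density is symmetric in mean and argument, and the mean is affine in `x` with slope
`1 - c ρ Δ⁺`, so a linear substitution suffices. -/
theorem lintegral_abilityKernel_left (C : Constants) (I : Individual) (phi c : ℝ) (t : Fin I.T)
    (h : 1 - c * C.rho * truncLapse C I t ≠ 0) (y : ℝ) :
    ∫⁻ x, abilityKernel C I phi c t x y ≤ .ofReal |1 - c * C.rho * truncLapse C I t|⁻¹ := by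
  have := lintegral_comp_affine h (c * truncLapse C I t)
    (f := fun z => .ofReal (normalDensity z (I.lapse t / phi) y)) (by fun_prop)
  simp only [normalDensity_comm _ _ y] at this
  unfold abilityKernel
  calc _ = _ := by
        rw [← this]; congr 1; ext x; rw [normalDensity_comm]; congr 2; ring
    _ ≤ _ := mul_le_of_le_one_right' (lintegral_normalDensity_le_one _ _)

/-- The expectation of `f` of the ability on day `k + 1`, given `φ` and `c`. -/
noncomputable def abilityMean (C : Constants) (I : Individual) (phi c : ℝ) (k : Fin I.T)
    (f : ℝ → ℝ≥0∞) : ℝ≥0∞ :=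
  ∫⁻ θ : Fin (I.T + 1) → ℝ, .ofReal (normalDensity I.mu I.V (θ 0)) *
    (∏ t : Fin I.T, abilityKernel C I phi c t (θ t.castSucc) (θ t.succ)) * f (θ k.succ)

theorem abilityMean_eq (C : Constants) (I : Individual) (phi c : ℝ) (k : Fin I.T)
    {f : ℝ → ℝ≥0∞} (hf : Measurable f) : abilityMean C I phi c k f =
      ∫⁻ x, .ofReal (normalDensity I.mu I.V x) * chainMean (abilityKernel C I phi c) k f x := by
  have hp := measurable_abilityKernel C I phi c
  unfold abilityMean
  have h0 : Measurable fun θ : Fin (I.T + 1) → ℝ =>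
      ∏ t : Fin I.T, abilityKernel C I phi c t (θ t.castSucc) (θ t.succ) :=
    Finset.measurable_fun_prod _ fun t _ => (hp t).comp
      (f := fun θ : Fin (I.T + 1) → ℝ => (θ t.castSucc, θ t.succ)) (by fun_prop)
  have h1 : Measurable fun θ : Fin (I.T + 1) → ℝ => ENNReal.ofReal (normalDensity I.mu I.V (θ 0)) *
      (∏ t : Fin I.T, abilityKernel C I phi c t (θ t.castSucc) (θ t.succ)) * f (θ k.succ) :=
    (Measurable.mul (by fun_prop) h0).mul (by fun_prop)
  rw [lintegral_pi_insertNth 0 h1]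
  refine lintegral_congr fun x => ?_
  have h2 : Measurable (pathDensity (abilityKernel C I phi c) x) :=
    measurable_pathDensity_right hp x
  have h4 : Measurable fun θ : Fin I.T → ℝ => pathDensity (abilityKernel C I phi c) x θ * f (θ k) :=
    h2.mul (by fun_prop)
  unfold chainMean
  rw [← lintegral_const_mul _ h4]
  refine lintegral_congr fun θ => ?_
  rw [← mul_assoc]
  simp only [Fin.insertNth_zero]
  congr 1

/-- For bounded `c` the powers of `(1 + c)⁻¹` are bounded below, so mass and density bounds suffice.
For large `c` every transition contracts Lebesgue mass by `q` of order `1 / c`. Two factors `q` come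
from bounding the initial normal density, or one factor `q` together with `√φ` from bounding the
first transition density. -/
theorem exists_abilityMean_le (C : Constants) (I : Individual) (hrho : C.rho ≠ 0)
    (hmax : 0 < C.maxLapse) (hlapse : ∀ t, 0 < I.lapse t) (hV : 0 < I.V) :
    ∃ K : ℝ, 0 < K ∧ ∀ phi c : ℝ, 0 < phi → 0 < c → ∀ k : Fin I.T, 1 ≤ (k : ℕ) →
      ∀ (f : ℝ → ℝ≥0∞) (M N : ℝ≥0∞), Measurable f → (∀ x, f x ≤ M) → M ≤ N → ∫⁻ x, f x ≤ N →
      abilityMean C I phi c k f ≤ M ∧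
      abilityMean C I phi c k f ≤ .ofReal (K * (min 1 √phi * (1 + c)⁻¹)) * N ∧
      abilityMean C I phi c k f ≤ .ofReal (K * (1 + c)⁻¹ ^ 2) * N := by
  set D := truncLapse C I with hD
  have hDpos : ∀ t, 0 < D t := fun t => lt_min (hlapse t) hmax
  have hrho' : 0 < |C.rho| := abs_pos.2 hrho
  -- Beyond this threshold `c |ρ| D t ≥ 2` on every day, hence `|1 - c ρ D t| ≥ c |ρ| D t / 2`.
  set c0 : ℝ := 1 + ∑ t, 2 / (|C.rho| * D t) with hc0
  have hterm : ∀ t, 0 < 2 / (|C.rho| * D t) := fun t => by have := hDpos t; positivity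
  have hc0t : ∀ t, 2 / (|C.rho| * D t) ≤ c0 := fun t => by
    have := Finset.single_le_sum (f := fun t => 2 / (|C.rho| * D t)) (fun t _ => (hterm t).le)
      (Finset.mem_univ t)
    simp only [hc0]; linarith
  have hc01 : 1 ≤ c0 := by
    have : 0 ≤ ∑ t, 2 / (|C.rho| * D t) := Finset.sum_nonneg fun t _ => (hterm t).le
    linarith
  set s1 : ℝ := 1 + ∑ t, (√(I.lapse t))⁻¹ with hs1
  have hs1t : ∀ t, (√(I.lapse t))⁻¹ ≤ s1 := fun t => by
    have := Finset.single_le_sum (f := fun t => (√(I.lapse t))⁻¹) (fun t _ => by positivity)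
      (Finset.mem_univ t)
    simp only [hs1]; linarith
  have hs11 : 1 ≤ s1 := by
    have : 0 ≤ ∑ t, (√(I.lapse t))⁻¹ := Finset.sum_nonneg fun t _ => by positivity
    linarith
  set s0 : ℝ := 1 + (√I.V)⁻¹ with hs0
  have hs01 : 1 ≤ s0 := by simp only [hs0]; linarith [show 0 ≤ (√I.V)⁻¹ by positivity]
  refine ⟨s0 * s1 * (2 * c0) ^ 2, by positivity, ?_⟩
  intro phi c hphi hc k hk f M N hf hM hMN hfN
  have hp := measurable_abilityKernel C I phi c
  have h1 : ∀ t x, ∫⁻ y, abilityKernel C I phi c t x y ≤ 1 :=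
    fun t x => lintegral_normalDensity_le_one _ _
  have hs : ∀ t x y, abilityKernel C I phi c t x y ≤ .ofReal (s1 * √phi) := by
    intro t x y
    refine ENNReal.ofReal_le_ofReal ((normalDensity_le (div_pos (hlapse t) hphi).le _ _).trans ?_)
    rw [Real.sqrt_div (hlapse t).le, inv_div, div_eq_mul_inv, mul_comm]
    gcongr
    exact hs1t t
  have hN : ∀ {E : ℝ≥0∞} {a b : ℝ}, E ≤ .ofReal a * ∫⁻ x, f x → a ≤ b → E ≤ .ofReal b * N :=
    fun h h' => h.trans (by gcongr)
  have hN' : ∀ {E : ℝ≥0∞} {b : ℝ}, E ≤ M → 1 ≤ b → E ≤ .ofReal b * N :=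
    fun h h' => h.trans (hMN.trans (le_mul_of_one_le_left' (by simpa using h')))
  rw [abilityMean_eq C I phi c k hf]
  set E := ∫⁻ x, .ofReal (normalDensity I.mu I.V x) * chainMean (abilityKernel C I phi c) k f x
  have e1 : E ≤ M :=
    lintegral_normalDensity_mul_le_sup _ _ fun x => chainMean_le_sup hp h1 hM k x
  have e2 : E ≤ .ofReal (s1 * √phi) * ∫⁻ x, f x :=
    lintegral_normalDensity_mul_le_sup _ _ fun x => chainMean_le_of_le hp h1 hf hs k x
  refine ⟨e1, ?_⟩
  have hr : 0 < (1 + c)⁻¹ := by positivity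
  have hsq : 0 < √phi := Real.sqrt_pos.2 hphi
  rcases le_or_gt c c0 with hcc | hcc
  -- Since `1 ≤ c0`, one has `1 + c ≤ 2 * c0` in this range, so factors `(1 + c)⁻¹` can be inserted
  -- at the cost of a constant.
  · have hrc : 1 ≤ (2 * c0) * (1 + c)⁻¹ := by
      rw [← div_eq_mul_inv, one_le_div (by positivity)]; linarith
    have h2c : 1 ≤ 2 * c0 := by linarith
    constructor
    · rcases le_total 1 √phi with h | h
      · refine hN' e1 ?_
        rw [min_eq_left h]
        calc 1 ≤ 1 * 1 * (2 * c0) * ((2 * c0) * (1 + c)⁻¹) := by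
              rw [one_mul, one_mul]; exact one_le_mul_of_one_le_of_one_le h2c hrc
          _ ≤ s0 * s1 * (2 * c0) * ((2 * c0) * (1 + c)⁻¹) := by gcongr
          _ = _ := by ring
      · refine hN e2 ?_
        rw [min_eq_right h]
        calc s1 * √phi = 1 * s1 * 1 * √phi * 1 := by ring
          _ ≤ s0 * s1 * (2 * c0) * √phi * ((2 * c0) * (1 + c)⁻¹) := by gcongr
          _ = _ := by ring
    · refine hN' e1 ?_
      calc 1 ≤ 1 * 1 * ((2 * c0) * (1 + c)⁻¹) ^ 2 := by
            rw [one_mul, one_mul]; exact one_le_pow₀ hrc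
        _ ≤ s0 * s1 * ((2 * c0) * (1 + c)⁻¹) ^ 2 := by gcongr
        _ = _ := by ring
  · set q : ℝ := c0 / c with hqdef
    have hqpos : 0 < q := by positivity
    have hq1 : q ≤ 1 := by rw [hqdef, div_le_one hc]; exact hcc.le
    have hqr : q ≤ 2 * c0 * (1 + c)⁻¹ := by
      rw [hqdef, ← div_eq_mul_inv, div_le_div_iff₀ hc (by positivity)]
      nlinarith
    have hq : ∀ t y, ∫⁻ x, abilityKernel C I phi c t x y ≤ .ofReal q := by
      intro t y
      have hb : c * |C.rho| * D t / 2 ≤ |1 - c * C.rho * D t| := by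
        have h3 : |c * C.rho * D t| = c * |C.rho| * D t := by
          rw [abs_mul, abs_mul, abs_of_pos hc, abs_of_pos (hDpos t)]
        have h4 : 2 ≤ c * (|C.rho| * D t) := by
          have := (div_le_iff₀ (mul_pos hrho' (hDpos t))).1 ((hc0t t).trans hcc.le)
          exact this
        have h5 := abs_sub_abs_le_abs_sub (c * C.rho * D t) 1
        rw [abs_sub_comm, h3, abs_one] at h5
        linarith
      have hbpos : 0 < c * |C.rho| * D t / 2 := by have := hDpos t; positivity
      refine (lintegral_abilityKernel_left C I phi c t (abs_pos.1 (hbpos.trans_le hb)) y).trans ?_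
      refine ENNReal.ofReal_le_ofReal ?_
      calc _ ≤ (c * |C.rho| * D t / 2)⁻¹ := by gcongr
        _ = 2 / (|C.rho| * D t) / c := by
          have := hDpos t; field_simp
        _ ≤ q := by rw [hqdef]; gcongr; exact hc0t t
    have hq1' : ENNReal.ofReal q ≤ 1 := by simpa using hq1
    have e3 : E ≤ .ofReal (s1 * √phi * q) * ∫⁻ x, f x := by
      rw [ENNReal.ofReal_mul (by positivity), mul_assoc]
      exact lintegral_normalDensity_mul_le_sup _ _ fun x =>
        chainMean_le_of_le_of_lintegral_le hp h1 hf hs hq1' hq k hk x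
    -- The initial density is at most `(√V)⁻¹`, and `1 ≤ k` leaves at least two contracting
    -- transitions.
    have e4 : E ≤ .ofReal (s0 * q ^ 2) * ∫⁻ x, f x := by
      rw [ENNReal.ofReal_mul (by positivity), mul_assoc]
      calc E ≤ .ofReal (√I.V)⁻¹ * ∫⁻ x, chainMean (abilityKernel C I phi c) k f x :=
            lintegral_normalDensity_mul_le hV.le _ (measurable_chainMean hp hf k)
        _ ≤ .ofReal s0 * (.ofReal q ^ (k + 1 : ℕ) * ∫⁻ y, f y) := by
            gcongr
            · simp [hs0]
            · exact lintegral_chainMean_le hp h1 hf hq k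
        _ ≤ .ofReal s0 * (.ofReal (q ^ 2) * ∫⁻ y, f y) := by
            rw [ENNReal.ofReal_pow hqpos.le]
            gcongr _ * (?_ * _)
            exact pow_le_pow_right_of_le_one' hq1' (by omega)
    constructor
    · rcases le_total 1 √phi with h | h
      · refine hN e4 ?_
        rw [min_eq_left h]
        calc s0 * q ^ 2 = s0 * 1 * q * q := by ring
          _ ≤ s0 * s1 * (2 * c0 * (1 + c)⁻¹) * (2 * c0) := by
              gcongr; linarith
          _ = _ := by ring
      · refine hN e3 ?_
        rw [min_eq_right h]
        calc s1 * √phi * q = 1 * s1 * √phi * q * 1 := by ring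
          _ ≤ s0 * s1 * √phi * (2 * c0 * (1 + c)⁻¹) * (2 * c0) := by
              gcongr; linarith
          _ = _ := by ring
    · refine hN e4 ?_
      calc s0 * q ^ 2 = s0 * 1 * q ^ 2 := by ring
        _ ≤ s0 * s1 * (2 * c0 * (1 + c)⁻¹) ^ 2 := by gcongr
        _ = _ := by ring

/-! ### The Kolmogorov--Smirnov density -/

/-- The absolute value of a term of the Kolmogorov--Smirnov density. -/
noncomputable def ksTerm (x : ℝ) (k : ℕ) : ℝ :=
  8 * (((k : ℝ) + 1) ^ 2 * x * Real.exp (-(2 * ((k : ℝ) + 1) ^ 2 * x ^ 2)))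

theorem ksTerm_nonneg {x : ℝ} (hx : 0 ≤ x) (k : ℕ) : 0 ≤ ksTerm x k := by
  unfold ksTerm; positivity

theorem ksDensity_of_nonneg {x : ℝ} (hx : 0 ≤ x) :
    ksDensity x = ∑' k : ℕ, (-1) ^ k * ksTerm x k := by
  rw [ksDensity, if_pos hx, ← tsum_mul_left]
  congr 1; ext k
  rw [ksTerm, pow_add]
  ring

theorem summable_inv_add_one_sq : Summable fun k : ℕ => (((k : ℝ) + 1) ^ 2)⁻¹ := by
  have := (summable_nat_add_iff 1).2 (Real.summable_nat_pow_inv.2 one_lt_two)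
  simpa using this

theorem exp_neg_le_inv_sq {y : ℝ} (hy : 0 < y) : Real.exp (-y) ≤ 2 * (y ^ 2)⁻¹ := by
  have := Real.quadratic_le_exp_of_nonneg hy.le
  rw [Real.exp_neg, ← div_eq_mul_inv, inv_le_comm₀ (Real.exp_pos _) (by positivity), inv_div]
  nlinarith

theorem ksTerm_le {a x : ℝ} (ha : 0 < a) (hx : a ≤ x) (k : ℕ) :
    ksTerm x k ≤ 4 * (a ^ 3)⁻¹ * (((k : ℝ) + 1) ^ 2)⁻¹ := by
  have hx0 : 0 < x := ha.trans_le hx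
  have hk : 0 < (k : ℝ) + 1 := by positivity
  calc ksTerm x k ≤ 8 * (((k : ℝ) + 1) ^ 2 * x * (2 * ((2 * ((k : ℝ) + 1) ^ 2 * x ^ 2) ^ 2)⁻¹)) := by
        unfold ksTerm
        gcongr
        exact exp_neg_le_inv_sq (by positivity)
    _ = 4 * (x ^ 3)⁻¹ * (((k : ℝ) + 1) ^ 2)⁻¹ := by field_simp; ring
    _ ≤ _ := by gcongr

theorem summable_ksTerm {x : ℝ} (hx : 0 ≤ x) : Summable (ksTerm x) := by
  rcases hx.eq_or_lt with rfl | hx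
  · have : ksTerm 0 = 0 := by ext k; simp [ksTerm]
    rw [this]
    exact summable_zero
  · exact .of_nonneg_of_le (ksTerm_nonneg hx.le) (ksTerm_le hx le_rfl)
      (summable_inv_add_one_sq.mul_left _)

theorem measurable_ksDensity : Measurable ksDensity := by
  refine measurable_of_tendsto_metrizable (f := fun n x => if 0 ≤ x then
    ∑ k ∈ Finset.range n, (-1) ^ k * ksTerm x k else 0) ?_ ?_
  · intro n
    refine Measurable.ite measurableSet_Ici ?_ measurable_const
    unfold ksTerm
    fun_prop
  · rw [tendsto_pi_nhds]
    intro x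
    by_cases hx : 0 ≤ x
    · simp only [if_pos hx, ksDensity_of_nonneg hx]
      exact (summable_ksTerm hx).tendsto_alternating_series_tsum
    · simp [ksDensity, hx]

/-- With `m = k + 1 ≥ 1`, the polynomial factor grows by at most `(1 + 1/m) ^ 2 ≤ 4`, while the
exponential shrinks by `exp (2 (2m + 1) x ^ 2) > 4`. -/
theorem ksTerm_succ_lt {x : ℝ} (hx : 1 ≤ x) (k : ℕ) : ksTerm x (k + 1) < ksTerm x k := by
  unfold ksTerm
  have hm : 1 ≤ (k : ℝ) + 1 := by simp
  push_cast
  set m : ℝ := (k : ℝ) + 1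
  have h1 : Real.exp (-(2 * m ^ 2 * x ^ 2)) =
      Real.exp (-(2 * (m + 1) ^ 2 * x ^ 2)) * Real.exp (2 * (2 * m + 1) * x ^ 2) := by
    rw [← Real.exp_add]; congr 1; ring
  have h2 : 4 < Real.exp (2 * (2 * m + 1) * x ^ 2) := by
    have := Real.add_one_le_exp (2 * (2 * m + 1) * x ^ 2)
    nlinarith [one_le_pow₀ hx (n := 2)]
  rw [h1]
  have he := Real.exp_pos (-(2 * (m + 1) ^ 2 * x ^ 2))
  have hx0 : 0 < x := by linarith
  have h3 : (m + 1) ^ 2 < m ^ 2 * Real.exp (2 * (2 * m + 1) * x ^ 2) := by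
    have : m ^ 2 * 4 < m ^ 2 * Real.exp (2 * (2 * m + 1) * x ^ 2) := by gcongr
    nlinarith
  calc _ = 8 * (x * Real.exp (-(2 * (m + 1) ^ 2 * x ^ 2))) * (m + 1) ^ 2 := by ring
    _ < 8 * (x * Real.exp (-(2 * (m + 1) ^ 2 * x ^ 2))) *
        (m ^ 2 * Real.exp (2 * (2 * m + 1) * x ^ 2)) := by gcongr
    _ = _ := by ring

theorem antitone_ksTerm {x : ℝ} (hx : 1 ≤ x) : Antitone (ksTerm x) :=
  antitone_nat_of_succ_le fun k => (ksTerm_succ_lt hx k).le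

/-- The alternating sum is at least its first term minus its second, and the terms strictly
decrease. -/
theorem ksDensity_pos_of_one_le {x : ℝ} (hx : 1 ≤ x) : 0 < ksDensity x := by
  have h := alternating_series_error_bound _ (antitone_ksTerm hx)
    (summable_ksTerm (zero_le_one.trans hx)) 1
  rw [← ksDensity_of_nonneg (zero_le_one.trans hx), abs_le] at h
  have := ksTerm_succ_lt hx 0
  simp at h this
  linarith

theorem ksDensity_le_of_one_le {x : ℝ} (hx : 1 ≤ x) :
    ksDensity x ≤ 8 * (x * Real.exp (-2 * x ^ 2)) := by
  -- The empty partial sum: the whole alternating series is bounded by its first term.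
  have h := alternating_series_error_bound _ (antitone_ksTerm hx)
    (summable_ksTerm (zero_le_one.trans hx)) 0
  rw [← ksDensity_of_nonneg (zero_le_one.trans hx), abs_le] at h
  simpa [ksTerm] using h.2

/-- The Kolmogorov--Smirnov distribution function, as a theta series. -/
noncomputable def ksCdf (x : ℝ) : ℝ := ∑' n : ℤ, (-1) ^ n * Real.exp (-(2 * n ^ 2 * x ^ 2))

/-- Poisson summation for a Gaussian, with the linear term chosen so that `exp (π i n) = (-1) ^ n`.
The alternating signs become a half-integer shift, so the dual series has positive terms. -/
theorem ksCdf_eq_dual {x : ℝ} (hx : 0 < x) : ksCdf x =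
    ∑' n : ℤ, √(Real.pi / 2) * (x⁻¹ * Real.exp (-(Real.pi ^ 2 * ((n : ℝ) - 1 / 2) ^ 2 / 2) / x ^ 2)) := by
  have ha : 0 < 2 * x ^ 2 / Real.pi := by positivity
  have h := Complex.tsum_exp_neg_quadratic (a := ((2 * x ^ 2 / Real.pi : ℝ) : ℂ))
    (by rwa [Complex.ofReal_re]) (Complex.I / 2)
  have hpi : (Real.pi : ℂ) ≠ 0 := by exact_mod_cast Real.pi_ne_zero
  have hxc : (x : ℂ) ≠ 0 := by exact_mod_cast hx.ne'
  have e1 : ∀ n : ℤ, Complex.exp (-Real.pi * ((2 * x ^ 2 / Real.pi : ℝ) : ℂ) * n ^ 2 +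
      2 * Real.pi * (Complex.I / 2) * n) =
      (((-1) ^ n * Real.exp (-(2 * n ^ 2 * x ^ 2)) : ℝ) : ℂ) := by
    intro n
    rw [Complex.exp_add, show 2 * (Real.pi : ℂ) * (Complex.I / 2) * n = n * (Real.pi * Complex.I) by ring,
      Complex.exp_int_mul, Complex.exp_pi_mul_I]
    push_cast
    rw [mul_comm]
    congr 2
    field_simp
  have e2 : ∀ n : ℤ, Complex.exp (-Real.pi / ((2 * x ^ 2 / Real.pi : ℝ) : ℂ) *
      (n + Complex.I * (Complex.I / 2)) ^ 2) =
      ((Real.exp (-(Real.pi ^ 2 * ((n : ℝ) - 1 / 2) ^ 2 / 2) / x ^ 2) : ℝ) : ℂ) := by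
    intro n
    rw [← mul_div_assoc, Complex.I_mul_I]
    push_cast
    congr 1
    field_simp
    ring
  have e3 : (1 : ℂ) / ((2 * x ^ 2 / Real.pi : ℝ) : ℂ) ^ (1 / 2 : ℂ) =
      ((√(Real.pi / 2) * x⁻¹ : ℝ) : ℂ) := by
    rw [show (1 / 2 : ℂ) = ((1 / 2 : ℝ) : ℂ) by norm_num, ← Complex.ofReal_cpow ha.le,
      ← Real.sqrt_eq_rpow, ← Complex.ofReal_one, ← Complex.ofReal_div]
    congr 1
    rw [one_div, ← Real.sqrt_inv, inv_div, ← div_div, Real.sqrt_div (by positivity),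
      Real.sqrt_sq hx.le, div_eq_mul_inv]
  simp only [e1, e2, e3] at h
  rw [← Complex.ofReal_tsum, ← Complex.ofReal_tsum, ← Complex.ofReal_mul] at h
  rw [ksCdf, Complex.ofReal_injective h, ← tsum_mul_left]
  simp only [mul_assoc]

theorem summable_ksCdf_dual {x : ℝ} (hx : 0 < x) : Summable fun n : ℤ =>
    √(Real.pi / 2) * (x⁻¹ * Real.exp (-(Real.pi ^ 2 * ((n : ℝ) - 1 / 2) ^ 2 / 2) / x ^ 2)) := by
  refine Summable.mul_left _ (Summable.mul_left _ ?_)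
  have h1 := ((Real.summable_one_div_int_add_rpow (-(1 / 2)) 2).2 one_lt_two).mul_left
    (2 * x ^ 2 / Real.pi ^ 2)
  refine Summable.of_nonneg_of_le (fun n => (Real.exp_pos _).le) (fun n => ?_) h1
  have hn : 0 < ((n : ℝ) + -(1 / 2)) ^ 2 := by
    refine sq_pos_of_ne_zero fun h => ?_
    have h2 : (2 * n : ℝ) = 1 := by linarith
    have h3 : 2 * n = 1 := by exact_mod_cast h2
    omega
  rw [Real.rpow_two, sq_abs]
  set y := ((n : ℝ) + -(1 / 2)) ^ 2 with hy
  have e : -(Real.pi ^ 2 * ((n : ℝ) - 1 / 2) ^ 2 / 2) / x ^ 2 = -(Real.pi ^ 2 * y / (2 * x ^ 2)) := by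
    rw [hy]; field_simp; ring
  rw [e, Real.exp_neg]
  have hpos : 0 < Real.pi ^ 2 * y / (2 * x ^ 2) := by positivity
  have := Real.add_one_le_exp (Real.pi ^ 2 * y / (2 * x ^ 2))
  calc _ ≤ (Real.pi ^ 2 * y / (2 * x ^ 2))⁻¹ := by gcongr; linarith
    _ = _ := by field_simp

/-- The logarithmic derivative of `x⁻¹ exp (-b / x ^ 2)` is `(2b - x ^ 2) / x ^ 3`, nonnegative up
to `√(2b) ≥ 3/2`. The proof replaces calculus by `1 + z ≤ exp z`. -/
theorem inv_mul_exp_neg_div_sq_mono {b x y : ℝ} (hb : 9 / 8 ≤ b) (hx : 0 < x) (hxy : x ≤ y)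
    (hy : y ≤ 3 / 2) : x⁻¹ * Real.exp (-b / x ^ 2) ≤ y⁻¹ * Real.exp (-b / y ^ 2) := by
  have hy0 : 0 < y := hx.trans_le hxy
  have h1 : Real.exp (-b / y ^ 2) =
      Real.exp (-b / x ^ 2) * Real.exp (b / x ^ 2 - b / y ^ 2) := by
    rw [← Real.exp_add]; congr 1; ring
  have h2 : y / x ≤ Real.exp (b / x ^ 2 - b / y ^ 2) := by
    refine le_trans ?_ (Real.add_one_le_exp _)
    have h3 : b / x ^ 2 - b / y ^ 2 + 1 - y / x =
        (y - x) * (b * (x + y) - x * y ^ 2) / (x ^ 2 * y ^ 2) := by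
      field_simp; ring
    have h4 : 0 ≤ b * (x + y) - x * y ^ 2 := by
      have : x * y ^ 2 ≤ x * (3 / 2) ^ 2 := by gcongr
      nlinarith
    have : 0 ≤ (y - x) * (b * (x + y) - x * y ^ 2) / (x ^ 2 * y ^ 2) := by
      have : 0 ≤ y - x := by linarith
      positivity
    linarith
  rw [h1]
  calc _ = y⁻¹ * (Real.exp (-b / x ^ 2) * (y / x)) := by field_simp
    _ ≤ _ := by gcongr

theorem ksCdf_nonneg {x : ℝ} (hx : 0 < x) : 0 ≤ ksCdf x := by
  rw [ksCdf_eq_dual hx]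
  exact tsum_nonneg fun n => by positivity

/-- Each term of the dual series is increasing: `(n - 1/2) ^ 2 ≥ 1/4` for integers, so the constant
in the exponent is at least `π ^ 2 / 8 ≥ 9 / 8`. -/
theorem monotoneOn_ksCdf : MonotoneOn ksCdf (Set.Ioc 0 (3 / 2)) := by
  intro x hx y hy hxy
  rw [ksCdf_eq_dual hx.1, ksCdf_eq_dual hy.1]
  refine (summable_ksCdf_dual hx.1).tsum_le_tsum (fun n => ?_) (summable_ksCdf_dual hy.1)
  gcongr ?_ * ?_
  refine inv_mul_exp_neg_div_sq_mono ?_ hx.1 hxy hy.2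
  have hn : 1 / 4 ≤ ((n : ℝ) - 1 / 2) ^ 2 := by
    have : 0 ≤ (n : ℝ) * (n - 1) := by
      rcases le_or_gt n 0 with h | h
      · have : (n : ℝ) ≤ 0 := by exact_mod_cast h
        nlinarith
      · have : (1 : ℝ) ≤ n := by exact_mod_cast h
        nlinarith
    nlinarith
  have hp : 9 ≤ Real.pi ^ 2 := by nlinarith [Real.pi_gt_three]
  nlinarith

theorem summable_ksCdf_nat {x : ℝ} (hx : 0 < x) : Summable fun k : ℕ =>
    Real.exp (-(2 * ((k : ℝ) + 1) ^ 2 * x ^ 2)) := by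
  refine .of_nonneg_of_le (fun k => (Real.exp_pos _).le) (fun k => ?_)
    ((summable_ksTerm hx.le).mul_left (x⁻¹))
  have : 1 ≤ 8 * ((k : ℝ) + 1) ^ 2 := by nlinarith [(Nat.cast_nonneg k : (0 : ℝ) ≤ k)]
  calc _ = 1 * Real.exp (-(2 * ((k : ℝ) + 1) ^ 2 * x ^ 2)) := (one_mul _).symm
    _ ≤ (8 * ((k : ℝ) + 1) ^ 2) * Real.exp (-(2 * ((k : ℝ) + 1) ^ 2 * x ^ 2)) := by gcongr
    _ = _ := by unfold ksTerm; field_simp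

theorem ksCdf_eq_nat {x : ℝ} (hx : 0 < x) : ksCdf x =
    1 + 2 * ∑' k : ℕ, (-1) ^ (k + 1) * Real.exp (-(2 * ((k : ℝ) + 1) ^ 2 * x ^ 2)) := by
  have hs : Summable fun n : ℤ => (-1 : ℝ) ^ n * Real.exp (-(2 * n ^ 2 * x ^ 2)) := by
    refine Summable.of_norm ?_
    simp only [norm_mul, norm_zpow, norm_neg, norm_one, one_zpow, one_mul, Real.norm_eq_abs,
      Real.abs_exp]
    have h1 : Summable fun k : ℕ => Real.exp (-(2 * (k : ℝ) ^ 2 * x ^ 2)) := by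
      rw [← summable_nat_add_iff 1]
      simpa using summable_ksCdf_nat hx
    refine summable_int_iff_summable_nat_and_neg.2 ⟨?_, ?_⟩
    · simpa using h1
    · simpa using h1
  rw [ksCdf, tsum_int_eq_zero_add_two_mul_tsum_pnat ?_ hs,
    tsum_pnat_eq_tsum_succ (f := fun n : ℕ => (-1 : ℝ) ^ (n : ℤ) *
      Real.exp (-(2 * ((n : ℤ) : ℝ) ^ 2 * x ^ 2)))]
  · simp only [Int.cast_zero, zpow_zero, zpow_natCast]
    push_cast
    simp
  · intro n
    simp [← inv_zpow]

/-- Termwise differentiation on `(x / 2, ∞)`, where `ksTerm_le` dominates the derivatives uniformly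
by a summable sequence. -/
theorem hasDerivAt_ksCdf {x : ℝ} (hx : 0 < x) : HasDerivAt ksCdf (ksDensity x) x := by
  have hx2 : 0 < x / 2 := by positivity
  have h := hasDerivAt_tsum_of_isPreconnected (𝕜 := ℝ) (F := ℝ)
    (u := fun k : ℕ => 4 * ((x / 2) ^ 3)⁻¹ * (((k : ℝ) + 1) ^ 2)⁻¹)
    (g := fun (k : ℕ) y => 2 * ((-1) ^ (k + 1) * Real.exp (-(2 * ((k : ℝ) + 1) ^ 2 * y ^ 2))))
    (g' := fun (k : ℕ) y => (-1) ^ k * ksTerm y k) (t := Set.Ioi (x / 2)) (y₀ := x) (y := x)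
    (summable_inv_add_one_sq.mul_left _) isOpen_Ioi isPreconnected_Ioi ?_ ?_ (by simpa using hx) ?_
    (by simpa using hx)
  · rw [← ksDensity_of_nonneg hx.le] at h
    refine (h.const_add 1).congr_of_eventuallyEq ?_
    filter_upwards [lt_mem_nhds hx] with y hy
    rw [ksCdf_eq_nat hy, tsum_mul_left]
  · intro k y _
    have h1 : HasDerivAt (fun y : ℝ => -(2 * ((k : ℝ) + 1) ^ 2 * y ^ 2))
        (-(2 * ((k : ℝ) + 1) ^ 2 * (2 * y))) y := by
      simpa using ((hasDerivAt_pow 2 y).const_mul (2 * ((k : ℝ) + 1) ^ 2)).fun_neg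
    refine ((h1.exp.const_mul ((-1) ^ (k + 1))).const_mul 2).congr_deriv ?_
    unfold ksTerm
    ring
  · intro k y hy
    rw [norm_mul, norm_pow, norm_neg, norm_one, one_pow, one_mul, Real.norm_eq_abs,
      abs_of_nonneg (ksTerm_nonneg (hx2.trans hy).le k)]
    exact ksTerm_le hx2 (le_of_lt hy) k
  · refine Summable.mul_left _ (Summable.of_norm ?_)
    simpa using summable_ksCdf_nat hx

/-- Below 3/2 the density is the derivative of an increasing function; from 1 on the alternating
series is positive. The two ranges overlap and cover `x > 0`. -/
theorem ksDensity_nonneg (x : ℝ) : 0 ≤ ksDensity x := by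
  rcases lt_or_ge 0 x with h0 | h0
  · rcases lt_or_ge x (3 / 2) with h1 | h1
    · have hs : Set.Ioc (0 : ℝ) (3 / 2) ∈ nhds x := Ioc_mem_nhds h0 h1
      refine (hasDerivAt_ksCdf h0).hasDerivWithinAt.nonneg_of_monotoneOn
        (s := Set.Ioc 0 (3 / 2)) ?_ monotoneOn_ksCdf
      rw [accPt_principal_iff_nhdsWithin]
      have : nhdsWithin x (Set.Ioc 0 (3 / 2) \ {x}) = nhdsWithin x {x}ᶜ := by
        rw [Set.sdiff_eq, Set.inter_comm]
        exact nhdsWithin_inter_of_mem' (mem_nhdsWithin_of_mem_nhds hs)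
      rw [this]
      infer_instance
    · exact (ksDensity_pos_of_one_le (by linarith)).le
  · rcases h0.eq_or_lt with rfl | h0
    · simp [ksDensity]
    · simp [ksDensity, h0.not_ge]

/-- On `(0, 1]` the density is the derivative of a monotone function, hence integrable; beyond 1 its
tail `8 x exp (-2 x ^ 2)` absorbs `exp (x ^ 2 / 2)`. -/
theorem lintegral_ksDensity_mul_exp_lt_top :
    ∫⁻ x, .ofReal (ksDensity x * Real.exp (x ^ 2 / 2)) < ∞ := by
  -- The value 0 at the left endpoint keeps the function monotone on the closed interval `[0, 1]`.
  set g : ℝ → ℝ := fun x => if 0 < x then ksCdf x else 0 with hg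
  have hgm : MonotoneOn g (Set.uIcc 0 1) := by
    intro x hx y hy hxy
    rw [Set.uIcc_of_le zero_le_one] at hx hy
    simp only [hg]
    split_ifs with h1 h2 h2
    · exact monotoneOn_ksCdf ⟨h1, by linarith [hx.2]⟩ ⟨h2, by linarith [hy.2]⟩ hxy
    · exact absurd (h1.trans_le hxy) h2
    · exact ksCdf_nonneg h2
    · rfl
  have hint := hgm.intervalIntegrable_deriv
  rw [intervalIntegrable_iff_integrableOn_Ioc_of_le zero_le_one] at hint
  have hderiv : ∀ x, 0 < x → deriv g x = ksDensity x := fun x hx => by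
    refine HasDerivAt.deriv ((hasDerivAt_ksCdf hx).congr_of_eventuallyEq ?_)
    filter_upwards [lt_mem_nhds hx] with y hy
    simp [hg, hy]
  have h1 : IntegrableOn (fun x => ksDensity x * Real.exp (1 / 2)) (Set.Ioc 0 1) :=
    (hint.congr_fun (fun x hx => hderiv x hx.1) measurableSet_Ioc).mul_const _
  have h2 : Integrable fun x : ℝ => 8 * (x * Real.exp (-(3 / 2) * x ^ 2)) :=
    (integrable_mul_exp_neg_mul_sq (by norm_num)).const_mul 8
  have key : ∀ x, ENNReal.ofReal (ksDensity x * Real.exp (x ^ 2 / 2)) ≤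
      (Set.Ioc 0 1).indicator (fun x => .ofReal (ksDensity x * Real.exp (1 / 2))) x +
      .ofReal (8 * (x * Real.exp (-(3 / 2) * x ^ 2))) := by
    intro x
    rcases lt_or_ge 0 x with h0 | h0
    · rcases le_or_gt x 1 with hx | hx
      · rw [Set.indicator_of_mem (s := Set.Ioc 0 1) ⟨h0, hx⟩]
        refine le_add_right (ENNReal.ofReal_le_ofReal ?_)
        have := ksDensity_nonneg x
        gcongr
        nlinarith
      · refine le_add_left (ENNReal.ofReal_le_ofReal ?_)
        calc _ ≤ 8 * (x * Real.exp (-2 * x ^ 2)) * Real.exp (x ^ 2 / 2) := by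
              gcongr; exact ksDensity_le_of_one_le hx.le
          _ = 8 * (x * (Real.exp (-2 * x ^ 2) * Real.exp (x ^ 2 / 2))) := by ring
          _ = _ := by rw [← Real.exp_add]; congr 3; ring
    · have : ksDensity x = 0 := by
        rcases h0.eq_or_lt with rfl | h0
        · simp [ksDensity]
        · simp [ksDensity, h0.not_ge]
      simp [this]
  refine (lintegral_mono key).trans_lt ?_
  rw [lintegral_add_right _ (by fun_prop), lintegral_indicator measurableSet_Ioc,
    ENNReal.add_lt_top]
  exact ⟨h1.setLIntegral_lt_top, h2.lintegral_lt_top⟩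

/-! ### Test effects -/

theorem dotProduct_sigmaInv_mulVec {m : ℕ} (η : Fin m → ℝ) :
    η ⬝ᵥ (sigmaInv m).mulVec η = ∑ j, η j ^ 2 + (∑ j, η j) ^ 2 := by
  have h : ∀ j, (sigmaInv m).mulVec η j = η j + ∑ k, η k := by
    intro j
    have : ∀ k, (if j = k then (2 : ℝ) else 1) * η k = (if j = k then η k else 0) + η k := by
      intro k; split_ifs <;> ring
    simp [Matrix.mulVec, dotProduct, sigmaInv, this, Finset.sum_add_distrib]
  simp only [dotProduct, h, mul_add, Finset.sum_add_distrib, ← Finset.sum_mul, sq]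

theorem testEffectDensity_pos {m : ℕ} {tau : ℝ} (ht : 0 < tau) (η : Fin m → ℝ) :
    0 < testEffectDensity tau η := by
  unfold testEffectDensity; positivity

/-- The quadratic form is `∑ η j ^ 2 + (∑ η j) ^ 2`; dropping the second square leaves independent
normals. -/
theorem testEffectDensity_le {m : ℕ} {tau : ℝ} (ht : 0 < tau) (η : Fin m → ℝ) :
    testEffectDensity tau η ≤ ∏ j, normalDensity 0 (1 / tau) (η j) := by
  have h1 : ∀ x, normalDensity 0 (1 / tau) x =
      (tau / (2 * Real.pi)) ^ (1 / 2 : ℝ) * Real.exp (-(tau * x ^ 2) / 2) := by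
    intro x
    rw [normalDensity_eq (by positivity), ← Real.sqrt_inv, ← Real.sqrt_eq_rpow]
    congr 2
    · field_simp
    · field_simp; ring
  simp only [h1, Finset.prod_mul_distrib, Finset.prod_const, Finset.card_univ, Fintype.card_fin]
  rw [← Real.exp_sum, testEffectDensity, ← Real.rpow_natCast, ← Real.rpow_mul (by positivity),
    dotProduct_sigmaInv_mulVec, ← Finset.sum_div, Finset.sum_neg_distrib, ← Finset.mul_sum,
    mul_comm (1 / 2 : ℝ), mul_one_div]
  gcongr
  nlinarith [sq_nonneg (∑ j, η j)]

@[fun_prop]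
theorem measurable_testEffectDensity {m : ℕ} :
    Measurable fun z : ℝ × (Fin m → ℝ) => testEffectDensity z.1 z.2 := by
  unfold testEffectDensity
  simp only [dotProduct_sigmaInv_mulVec]
  fun_prop

theorem lintegral_testEffectDensity_le_one {m : ℕ} {tau : ℝ} (ht : 0 < tau) :
    ∫⁻ η : Fin m → ℝ, .ofReal (testEffectDensity tau η) ≤ 1 := by
  calc _ ≤ ∫⁻ η : Fin m → ℝ, ∏ j, ENNReal.ofReal (normalDensity 0 (1 / tau) (η j)) := by
        gcongr with η
        rw [← ENNReal.ofReal_prod_of_nonneg fun _ _ => normalDensity_nonneg _ _ _]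
        exact ENNReal.ofReal_le_ofReal (testEffectDensity_le ht η)
    _ = ∏ j : Fin m, ∫⁻ x, .ofReal (normalDensity 0 (1 / tau) x) :=
        lintegral_fin_prod (f := fun _ x => ENNReal.ofReal (normalDensity 0 (1 / tau) x))
          fun _ => by fun_prop
    _ ≤ 1 := Finset.prod_le_one' fun _ _ => lintegral_normalDensity_le_one _ _

/-- For `τ ≥ 1` the total mass suffices. For `τ ≤ 1` the density of coordinate `s` is bounded by
`√τ`, the weight is integrated along that coordinate, and the others keep mass at most 1. -/
theorem lintegral_testEffectDensity_mul_le {m : ℕ} {tau : ℝ} (ht : 0 < tau) (s : Fin m)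
    {w : (Fin m → ℝ) → ℝ≥0∞} (hw : Measurable w) (hw1 : ∀ η, w η ≤ 1) {B : ℝ≥0∞} (hB : 1 ≤ B)
    (hwB : ∀ η, ∫⁻ x, w (Function.update η s x) ≤ B) :
    ∫⁻ η : Fin m → ℝ, .ofReal (testEffectDensity tau η) * w η ≤ B * .ofReal (min 1 √tau) := by
  rcases le_total 1 √tau with h | h
  · rw [min_eq_left h, ENNReal.ofReal_one, mul_one]
    refine le_trans ?_ hB
    refine le_trans ?_ (lintegral_testEffectDensity_le_one (m := m) ht)
    gcongr with η
    exact mul_le_of_le_one_right' (hw1 η)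
  rw [min_eq_right h]
  cases m with
  | zero => exact s.elim0
  | succ m =>
    calc _ ≤ ∫⁻ η : Fin (m + 1) → ℝ,
            (∏ j, ENNReal.ofReal (normalDensity 0 (1 / tau) (η j))) * w η := by
          gcongr with η
          rw [← ENNReal.ofReal_prod_of_nonneg fun _ _ => normalDensity_nonneg _ _ _]
          exact ENNReal.ofReal_le_ofReal (testEffectDensity_le ht η)
      _ = ∫⁻ y : Fin m → ℝ, ∫⁻ x : ℝ, (∏ j, ENNReal.ofReal (normalDensity 0 (1 / tau)
            (Fin.insertNth (α := fun _ => ℝ) s x y j))) *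
            w (Fin.insertNth (α := fun _ => ℝ) s x y) :=
          lintegral_pi_insertNth_symm s (by fun_prop)
      _ ≤ ∫⁻ y : Fin m → ℝ, (∏ j, ENNReal.ofReal (normalDensity 0 (1 / tau) (y j))) *
            (B * .ofReal √tau) := by
          gcongr with y
          obtain ⟨z, hins⟩ : ∃ z : Fin (m + 1) → ℝ, ∀ x,
              Fin.insertNth (α := fun _ => ℝ) s x y = Function.update z s x :=
            ⟨Fin.insertNth (α := fun _ => ℝ) s 0 y, fun x => by rw [Fin.update_insertNth]⟩
          have hwm : Measurable fun x => w (Fin.insertNth (α := fun _ => ℝ) s x y) := by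
            simp only [hins]
            exact hw.comp (measurable_update _)
          simp only [Fin.prod_univ_succAbove _ s, Fin.insertNth_apply_same,
            Fin.insertNth_apply_succAbove]
          calc _ = ∫⁻ x, (∏ j, ENNReal.ofReal (normalDensity 0 (1 / tau) (y j))) *
                (.ofReal (normalDensity 0 (1 / tau) x) *
                  w (Fin.insertNth (α := fun _ => ℝ) s x y)) := by
                congr 1; ext x; ring
            _ = (∏ j, ENNReal.ofReal (normalDensity 0 (1 / tau) (y j))) *
                ∫⁻ x, .ofReal (normalDensity 0 (1 / tau) x) *
                  w (Fin.insertNth (α := fun _ => ℝ) s x y) :=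
                lintegral_const_mul _ (by fun_prop)
            _ ≤ _ := by
                gcongr
                refine (lintegral_normalDensity_mul_le (by positivity) 0 hwm).trans ?_
                rw [mul_comm, one_div, Real.sqrt_inv, inv_inv]
                gcongr
                simpa only [hins] using hwB _
      _ = (∏ j : Fin m, ∫⁻ x, .ofReal (normalDensity 0 (1 / tau) x)) * (B * .ofReal √tau) := by
          rw [lintegral_mul_const _ (by fun_prop),
            lintegral_fin_prod (f := fun _ x => ENNReal.ofReal (normalDensity 0 (1 / tau) x))
            fun _ => by fun_prop]
      _ ≤ _ := mul_le_of_le_one_left' (Finset.prod_le_one' fun _ _ =>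
          lintegral_normalDensity_le_one _ _)

@[fun_prop]
theorem measurable_testEffect {S : ℕ} (s : Fin S) :
    Measurable fun η : Fin (S - 1) → ℝ => testEffect η s := by
  unfold testEffect
  split_ifs <;> fun_prop

/-- The difference of two test effects is an affine function with slope at least one of the
coordinate that belongs to the first one. -/
theorem testEffect_update_sub {S : ℕ} {s s' : Fin S} (h : (s : ℕ) < S - 1) (hne : s ≠ s')
    (η : Fin (S - 1) → ℝ) : ∃ α β : ℝ, 1 ≤ α ∧ ∀ x,
      testEffect (Function.update η ⟨s, h⟩ x) s - testEffect (Function.update η ⟨s, h⟩ x) s' =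
        α * x + β := by
  by_cases h' : (s' : ℕ) < S - 1
  · refine ⟨1, -η ⟨s', h'⟩, le_rfl, fun x => ?_⟩
    have : (⟨s', h'⟩ : Fin (S - 1)) ≠ ⟨s, h⟩ := fun e => hne (Fin.ext (by simpa using e.symm))
    simp [testEffect, h, h', Function.update_of_ne this]
    ring
  -- Here `s'` is the last test, whose effect is minus the sum of the others, so the coordinate
  -- enters twice.
  · refine ⟨2, ∑ j ∈ Finset.univ \ {⟨s, h⟩}, η j, one_le_two, fun x => ?_⟩
    simp only [testEffect, h, h', dite_true, dite_false, Function.update_self]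
    rw [Finset.sum_update_of_mem (Finset.mem_univ _)]
    ring

/-! ### Bounds for the likelihood of one day -/

/-- Bounds for the probability of a response given the predictor `v`, which hold in both forms of
the model. -/
structure ResponseBound (R : Bool → ℝ → ℝ≥0∞) (K : ℝ≥0∞) : Prop where
  meas : ∀ x, Measurable (R x)
  one_le : 1 ≤ K
  ne_top : K ≠ ∞
  le : ∀ x v, R x v ≤ K
  le_true : ∀ v, R true v ≤ K * .ofReal (Real.exp (v / 2))
  le_false : ∀ v, R false v ≤ K * .ofReal (Real.exp (-v / 2))

theorem prod_le_pow_mul_of_le {ι : Type*} [Fintype ι] [DecidableEq ι] {f : ι → ℝ≥0∞} {K c : ℝ≥0∞}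
    (h : ∀ i, f i ≤ K) (i₀ : ι) (h₀ : f i₀ ≤ K * c) : ∏ i, f i ≤ K ^ Fintype.card ι * c := by
  calc ∏ i, f i ≤ ∏ i, K * (if i = i₀ then c else 1) := by
        refine Finset.prod_le_prod' fun i _ => ?_
        split_ifs with hi
        · rwa [hi]
        · simpa using h i
    _ = _ := by simp only [Finset.prod_mul_distrib]; simp

/-- A response 0 is unlikely when `v` is large and a response 1 when `-v` is large; having both
gives decay on either side. -/
theorem ResponseBound.mixedTest_le {R : Bool → ℝ → ℝ≥0∞} {K : ℝ≥0∞} (hR : ResponseBound R K)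
    {I : Individual} {t : Fin I.T} {s : Fin (I.S t)} (h : I.MixedTest t s) (v : ℝ) :
    ∏ l, R (I.X t s l) v ≤ K ^ I.K t s * .ofReal (Real.exp (-(|v| / 2))) := by
  obtain ⟨⟨l₀, h₀⟩, l₁, h₁⟩ := h
  have hle : ∀ l, R (I.X t s l) v ≤ K := fun l => hR.le _ _
  rcases le_total 0 v with hv | hv
  · have := prod_le_pow_mul_of_le hle l₀ (by rw [h₀]; exact hR.le_false v)
    rw [abs_of_nonneg hv]
    rwa [Fintype.card_fin, neg_div] at this
  · have := prod_le_pow_mul_of_le hle l₁ (by rw [h₁]; exact hR.le_true v)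
    rw [abs_of_nonpos hv, neg_div, neg_neg]
    rwa [Fintype.card_fin] at this

/-- From `|v s - v s'| ≤ |v s| + |v s'|`, half the decay of the two tests can be spent on the
difference of predictors, which no longer involves ability or daily effect. -/
theorem ResponseBound.informativeDay_le {R : Bool → ℝ → ℝ≥0∞} {K : ℝ≥0∞} (hR : ResponseBound R K)
    {I : Individual} {t : Fin I.T} {s s' : Fin (I.S t)} (hne : s ≠ s')
    (h : I.MixedTest t s) (h' : I.MixedTest t s') (v : Fin (I.S t) → ℝ) :
    ∏ s, ∏ l, R (I.X t s l) (v s) ≤ (∏ s, K ^ I.K t s) *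
      (.ofReal (Real.exp (-(|v s - v s'| / 4))) * .ofReal (Real.exp (-(|v s| / 4)))) := by
  calc _ ≤ ∏ r, K ^ I.K t r * ((if r = s then .ofReal (Real.exp (-(|v s| / 2))) else 1) *
          (if r = s' then .ofReal (Real.exp (-(|v s'| / 2))) else 1)) := by
        refine Finset.prod_le_prod' fun r _ => ?_
        by_cases h1 : r = s
        · subst h1
          simpa [hne] using hR.mixedTest_le h (v r)
        by_cases h2 : r = s'
        · subst h2
          simpa [h1] using hR.mixedTest_le h' (v r)
        · simp only [h1, h2, if_false, mul_one]
          refine (Finset.prod_le_pow_card _ _ K fun l _ => hR.le _ _).trans ?_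
          simp
    _ = (∏ s, K ^ I.K t s) *
          (.ofReal (Real.exp (-(|v s| / 2))) * .ofReal (Real.exp (-(|v s'| / 2)))) := by
        simp only [Finset.prod_mul_distrib]; simp
    _ ≤ _ := by
        rw [← ENNReal.ofReal_mul (Real.exp_pos _).le, ← ENNReal.ofReal_mul (Real.exp_pos _).le,
          ← Real.exp_add, ← Real.exp_add]
        gcongr _ * ENNReal.ofReal (Real.exp ?_)
        have := abs_sub (v s) (v s')
        have := abs_nonneg (v s')
        linarith

theorem lintegral_exp_neg_abs_affine_le {α : ℝ} (hα : 1 ≤ α) (β : ℝ) :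
    ∫⁻ x : ℝ, .ofReal (Real.exp (-(|α * x + β| / 4))) ≤ 8 := by
  have h := lintegral_exp_neg_abs (b := 1 / 4) (by norm_num)
  rw [lintegral_comp_affine (by positivity) β
    (f := fun x => .ofReal (Real.exp (-(|x| / 4)))) (by fun_prop)]
  simp only [one_div_mul_eq_div] at h
  rw [h, ← ENNReal.ofReal_mul (by positivity), ENNReal.ofReal_le_ofNat]
  have : |α|⁻¹ ≤ 1 := inv_le_one_of_one_le₀ (hα.trans (le_abs_self α))
  norm_num
  linarith

theorem ResponseBound.exists_informativeDay_bound {R : Bool → ℝ → ℝ≥0∞} {K : ℝ≥0∞}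
    (hR : ResponseBound R K) {I : Individual} {t : Fin I.T} (h : I.InformativeDay t) :
    ∃ (w : (Fin (I.S t - 1) → ℝ) → ℝ≥0∞) (b : (Fin (I.S t - 1) → ℝ) → ℝ),
      Measurable w ∧ (∀ η, w η ≠ ∞) ∧ Measurable b ∧
      (∀ tau, 0 < tau → ∫⁻ η, .ofReal (testEffectDensity tau η) * w η ≤
        8 * .ofReal (min 1 √tau)) ∧
      ∀ (x d : ℝ) (η : Fin (I.S t - 1) → ℝ),
        ∏ s, ∏ l, R (I.X t s l) (x - I.a t s + d + testEffect η s) ≤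
          (∏ s, K ^ I.K t s) * (w η * .ofReal (Real.exp (-(|x + d + b η| / 4)))) := by
  -- Only the last test lacks a free coordinate, so one of two distinct tests can be taken to have
  -- one.
  obtain ⟨s, s', hne, hs, hs', hlt⟩ : ∃ s s' : Fin (I.S t), s ≠ s' ∧ I.MixedTest t s ∧
      I.MixedTest t s' ∧ (s : ℕ) < I.S t - 1 := by
    obtain ⟨-, s, s', hne, hs, hs'⟩ := h
    by_cases h1 : (s : ℕ) < I.S t - 1
    · exact ⟨s, s', hne, hs, hs', h1⟩
    · refine ⟨s', s, hne.symm, hs', hs, ?_⟩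
      have : (s : ℕ) ≠ s' := fun e => hne (Fin.ext e)
      omega
  refine ⟨fun η => .ofReal (Real.exp (-(|testEffect η s - testEffect η s' +
    (I.a t s' - I.a t s)| / 4))), fun η => testEffect η s - I.a t s, by fun_prop,
    fun η => ENNReal.ofReal_ne_top, by fun_prop, fun tau htau => ?_,
    fun x d η => ?_⟩
  · refine lintegral_testEffectDensity_mul_le htau ⟨s, hlt⟩ (by fun_prop) (fun η => ?_)
      (by norm_num) fun η => ?_
    · rw [ENNReal.ofReal_le_one, Real.exp_le_one_iff]
      have := abs_nonneg (testEffect η s - testEffect η s' + (I.a t s' - I.a t s))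
      linarith
    · obtain ⟨α, β, hα, hx⟩ := testEffect_update_sub hlt hne η
      simp only [hx, add_assoc]
      exact lintegral_exp_neg_abs_affine_le hα _
  · have := hR.informativeDay_le hne hs hs' fun s => x - I.a t s + d + testEffect η s
    refine this.trans (le_of_eq ?_)
    congr 6
    · ring_nf
    · ring_nf

/-! ### Integrating out the base parameters of one individual -/

/-- Tonelli's theorem for six variables, in the order that is used for the base parameters. -/
theorem lintegral_prod_six {A B D E F G : Type*} [MeasureSpace A] [MeasureSpace B] [MeasureSpace D]
    [MeasureSpace E] [MeasureSpace F] [MeasureSpace G] [SFinite (volume : Measure A)]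
    [SFinite (volume : Measure B)] [SFinite (volume : Measure D)] [SFinite (volume : Measure E)]
    [SFinite (volume : Measure F)] [SFinite (volume : Measure G)]
    {f : A × B × D × E × F × G → ℝ≥0∞} (hf : Measurable f) :
    ∫⁻ p, f p = ∫⁻ b, ∫⁻ d, ∫⁻ e, ∫⁻ z, ∫⁻ x, ∫⁻ y, f (x, b, d, e, y, z) := by
  have h0 : Measurable fun q : B × D × E × F × G => ∫⁻ a, f (a, q) :=
    hf.lintegral_prod_left'
  rw [Measure.volume_eq_prod, lintegral_prod_symm' _ hf, Measure.volume_eq_prod,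
    lintegral_prod _ h0.aemeasurable]
  refine lintegral_congr fun b => ?_
  have h1 : Measurable fun q : D × E × F × G => ∫⁻ a, f (a, b, q) := h0.comp (by fun_prop)
  rw [Measure.volume_eq_prod, lintegral_prod _ h1.aemeasurable]
  refine lintegral_congr fun d => ?_
  have h2 : Measurable fun q : E × F × G => ∫⁻ a, f (a, b, d, q) := h1.comp (by fun_prop)
  rw [Measure.volume_eq_prod, lintegral_prod _ h2.aemeasurable]
  refine lintegral_congr fun e => ?_
  have h3 : Measurable fun q : F × G => ∫⁻ a, f (a, b, d, e, q) := h2.comp (by fun_prop)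
  rw [Measure.volume_eq_prod, lintegral_prod_symm' _ h3]
  refine lintegral_congr fun z => ?_
  have h4 : Measurable fun q : F × A => f (q.2, b, d, e, q.1, z) := hf.comp (by fun_prop)
  exact lintegral_lintegral_swap h4.aemeasurable

theorem ofReal_baseDensity (C : Constants) (I : Individual) (phi : ℝ) (θ : Fin (I.T + 1) → ℝ)
    (c δ τ : ℝ) (day : Fin I.T → ℝ) (η : (t : Fin I.T) → Fin (I.S t - 1) → ℝ) :
    ENNReal.ofReal (baseDensity C I phi (θ, c, δ, τ, day, η)) =
      .ofReal (growthPrior c) * .ofReal (precisionPrior δ) * .ofReal (precisionPrior τ) *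
      (.ofReal (normalDensity I.mu I.V (θ 0)) *
        ∏ t : Fin I.T, abilityKernel C I phi c t (θ t.castSucc) (θ t.succ)) *
      (∏ t, .ofReal (normalDensity 0 (1 / δ) (day t))) *
      ∏ t, .ofReal (testEffectDensity τ (η t)) := by
  -- Nonnegativity of the test effect density is available only for positive `τ`; otherwise the
  -- prior makes both sides 0.
  rcases le_or_gt τ 0 with hτ | hτ
  · simp [baseDensity, precisionPrior, hτ.not_gt]
  have hn : ∀ m v x, 0 ≤ normalDensity m v x := normalDensity_nonneg
  have hg := growthPrior_nonneg c
  have hp := precisionPrior_nonneg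
  have hN : ∀ (m v x : Fin I.T → ℝ), 0 ≤ ∏ t, normalDensity (m t) (v t) (x t) :=
    fun m v x => Finset.prod_nonneg fun t _ => hn _ _ _
  unfold baseDensity abilityKernel
  simp only
  have h1 := mul_nonneg (mul_nonneg (mul_nonneg (hn I.mu I.V (θ 0)) hg) (hp δ)) (hp τ)
  have h2 := mul_nonneg h1 (hN (fun t => θ t.castSucc + c * (1 - C.rho * θ t.castSucc) *
    truncLapse C I t) (fun t => I.lapse t / phi) fun t => θ t.succ)
  have h3 := mul_nonneg h2 (hN (fun _ => 0) (fun _ => 1 / δ) day)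
  rw [ENNReal.ofReal_mul h3, ENNReal.ofReal_mul h2, ENNReal.ofReal_mul h1,
    ENNReal.ofReal_mul (mul_nonneg (mul_nonneg (hn I.mu I.V (θ 0)) hg) (hp δ)),
    ENNReal.ofReal_mul (mul_nonneg (hn I.mu I.V (θ 0)) hg), ENNReal.ofReal_mul (hn I.mu I.V (θ 0)),
    ENNReal.ofReal_prod_of_nonneg (fun _ _ => hn _ _ _),
    ENNReal.ofReal_prod_of_nonneg (fun _ _ => hn _ _ _),
    ENNReal.ofReal_prod_of_nonneg (fun _ _ => (testEffectDensity_pos hτ _).le)]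
  ring

/-- The weights sum to 1. They are chosen so that the resulting powers of `δ`, `c` and `φ` (the last
over two individuals) all exceed the critical exponent. -/
theorem le_mul_of_le_of_le_of_le_interpolate {E a b d N : ℝ≥0∞} (h1 : E ≤ a * N) (h2 : E ≤ b * N)
    (h3 : E ≤ d * N) :
    E ≤ a ^ (1 / 8 : ℝ) * b ^ (5 / 8 : ℝ) * d ^ (1 / 4 : ℝ) * N := by
  have split : ∀ x : ℝ≥0∞, x = x ^ (1 / 8 : ℝ) * x ^ (5 / 8 : ℝ) * x ^ (1 / 4 : ℝ) := by
    intro x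
    rw [← ENNReal.rpow_add_of_nonneg _ _ (by norm_num) (by norm_num),
      ← ENNReal.rpow_add_of_nonneg _ _ (by norm_num) (by norm_num)]
    norm_num
  calc E = E ^ (1 / 8 : ℝ) * E ^ (5 / 8 : ℝ) * E ^ (1 / 4 : ℝ) := split E
    _ ≤ (a * N) ^ (1 / 8 : ℝ) * (b * N) ^ (5 / 8 : ℝ) * (d * N) ^ (1 / 4 : ℝ) := by gcongr
    _ = a ^ (1 / 8 : ℝ) * b ^ (5 / 8 : ℝ) * d ^ (1 / 4 : ℝ) *
        (N ^ (1 / 8 : ℝ) * N ^ (5 / 8 : ℝ) * N ^ (1 / 4 : ℝ)) := by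
      rw [ENNReal.mul_rpow_of_nonneg _ _ (by norm_num), ENNReal.mul_rpow_of_nonneg _ _ (by norm_num),
        ENNReal.mul_rpow_of_nonneg _ _ (by norm_num)]
      ring
    _ = _ := by rw [← split N]

/-- A function smoothed by a centred normal density of precision `δ`. -/
noncomputable def smoothed (δ : ℝ) (g : ℝ → ℝ≥0∞) (x : ℝ) : ℝ≥0∞ :=
  ∫⁻ y, .ofReal (normalDensity 0 (1 / δ) y) * g (x + y)

theorem measurable_smoothed {δ : ℝ} {g : ℝ → ℝ≥0∞} (hg : Measurable g) :
    Measurable (smoothed δ g) := by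
  unfold smoothed
  exact Measurable.lintegral_prod_right' (ν := volume) (f := fun z : ℝ × ℝ =>
    ENNReal.ofReal (normalDensity 0 (1 / δ) z.2) * g (z.1 + z.2)) (by fun_prop)

theorem smoothed_le_one {δ : ℝ} {g : ℝ → ℝ≥0∞} (hg : ∀ x, g x ≤ 1) (x : ℝ) : smoothed δ g x ≤ 1 :=
  lintegral_normalDensity_mul_le_sup _ _ fun _ => hg _

/-- A normal density of precision `δ` is at most `√δ`, which helps for small `δ`; for large `δ` the
bound `g ≤ 1` is used. -/
theorem smoothed_le {δ : ℝ} (hδ : 0 < δ) {g : ℝ → ℝ≥0∞} (hgm : Measurable g) (hg : ∀ x, g x ≤ 1)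
    {N : ℝ≥0∞} (hN : 1 ≤ N) (hgN : ∫⁻ x, g x ≤ N) (x : ℝ) :
    smoothed δ g x ≤ .ofReal (min 1 √δ) * N := by
  rcases le_total 1 √δ with h | h
  · rw [min_eq_left h, ENNReal.ofReal_one, one_mul]
    exact (smoothed_le_one hg x).trans hN
  · rw [min_eq_right h]
    refine (lintegral_normalDensity_mul_le (by positivity) 0 (f := fun y => g (x + y))
      (by fun_prop)).trans ?_
    rw [one_div, Real.sqrt_inv, inv_inv, lintegral_add_left_eq_self]
    gcongr

theorem lintegral_smoothed_le {δ : ℝ} {g : ℝ → ℝ≥0∞} (hgm : Measurable g) :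
    ∫⁻ x, smoothed δ g x ≤ ∫⁻ x, g x := by
  unfold smoothed
  rw [lintegral_lintegral_swap (Measurable.aemeasurable (by unfold Function.uncurry; fun_prop))]
  have : ∀ y, ∫⁻ x, ENNReal.ofReal (normalDensity 0 (1 / δ) y) * g (x + y) =
      .ofReal (normalDensity 0 (1 / δ) y) * ∫⁻ x, g x := by
    intro y
    rw [lintegral_const_mul _ (by fun_prop), lintegral_add_right_eq_self]
  simp only [this]
  rw [lintegral_mul_const _ (by fun_prop)]
  exact mul_le_of_le_one_left' (lintegral_normalDensity_le_one _ _)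

/-- The integral over the abilities and daily effects, for fixed values of the other parameters. -/
theorem exists_lintegral_abilities_le (C : Constants) (I : Individual) (hrho : C.rho ≠ 0)
    (hmax : 0 < C.maxLapse) (hlapse : ∀ t, 0 < I.lapse t) (hV : 0 < I.V) {t k : Fin I.T}
    (htk : t ≠ k) (hk : 1 ≤ (k : ℕ)) {g : ℝ → ℝ≥0∞} (hgm : Measurable g) (hg : ∀ x, g x ≤ 1)
    (hg8 : ∫⁻ x, g x ≤ 8) :
    ∃ K : ℝ≥0∞, K ≠ ∞ ∧ ∀ phi c δ : ℝ, 0 < phi → 0 < c → 0 < δ → ∀ b : Fin I.T → ℝ,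
      ∫⁻ θ : Fin (I.T + 1) → ℝ, ∫⁻ day : Fin I.T → ℝ,
        (.ofReal (normalDensity I.mu I.V (θ 0)) *
          ∏ j : Fin I.T, abilityKernel C I phi c j (θ j.castSucc) (θ j.succ)) *
        ∏ j, (.ofReal (normalDensity 0 (1 / δ) (day j)) *
          (if j = t ∨ j = k then g (θ j.succ + b j + day j) else 1)) ≤
      K * .ofReal (min 1 √phi) ^ (5 / 8 : ℝ) * .ofReal (1 + c)⁻¹ ^ (9 / 8 : ℝ) *
        .ofReal (min 1 √δ) ^ (9 / 8 : ℝ) := by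
  obtain ⟨K, hK, hbound⟩ := exists_abilityMean_le C I hrho hmax hlapse hV
  refine ⟨8 * 8 * ENNReal.ofReal K ^ (5 / 8 : ℝ) * ENNReal.ofReal K ^ (1 / 4 : ℝ), ?_, ?_⟩
  · have : ∀ r : ℝ, 0 ≤ r → ENNReal.ofReal K ^ r ≠ ∞ :=
      fun r hr => ENNReal.rpow_ne_top_of_nonneg hr ENNReal.ofReal_ne_top
    exact ENNReal.mul_ne_top (ENNReal.mul_ne_top (by norm_num) (this _ (by norm_num)))
      (this _ (by norm_num))
  intro phi c δ hphi hc hδ b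
  set m := ENNReal.ofReal (min 1 √δ) with hm
  set r := ENNReal.ofReal (1 + c)⁻¹ with hr
  -- The daily effects are independent: day `t` contributes `m * 8` uniformly in the abilities, day
  -- `k` remains a function of its ability, and the other days integrate to at most 1.
  have hday : ∀ θ : Fin (I.T + 1) → ℝ, ∫⁻ day : Fin I.T → ℝ,
        (.ofReal (normalDensity I.mu I.V (θ 0)) *
          ∏ j : Fin I.T, abilityKernel C I phi c j (θ j.castSucc) (θ j.succ)) *
        ∏ j, (.ofReal (normalDensity 0 (1 / δ) (day j)) *
          (if j = t ∨ j = k then g (θ j.succ + b j + day j) else 1)) ≤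
      (m * 8) * ((.ofReal (normalDensity I.mu I.V (θ 0)) *
          ∏ j : Fin I.T, abilityKernel C I phi c j (θ j.castSucc) (θ j.succ)) *
        smoothed δ g (θ k.succ + b k)) := by
    intro θ
    have hfm : ∀ j : Fin I.T, Measurable fun y : ℝ =>
        ENNReal.ofReal (normalDensity 0 (1 / δ) y) *
          (if j = t ∨ j = k then g (θ j.succ + b j + y) else 1) := by
      intro j; split_ifs <;> fun_prop
    have hpm : Measurable fun day : Fin I.T → ℝ =>
        ∏ j, (ENNReal.ofReal (normalDensity 0 (1 / δ) (day j)) *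
          (if j = t ∨ j = k then g (θ j.succ + b j + day j) else 1)) :=
      Finset.measurable_fun_prod _ fun j _ => (hfm j).comp (measurable_pi_apply j)
    rw [lintegral_const_mul _ hpm,
      lintegral_fin_prod (f := fun j y => ENNReal.ofReal (normalDensity 0 (1 / δ) y) *
          (if j = t ∨ j = k then g (θ j.succ + b j + y) else 1)) hfm, mul_left_comm]
    gcongr
    calc _ ≤ ∏ j, (if j = t then m * 8 else 1) *
          (if j = k then smoothed δ g (θ k.succ + b k) else 1) := by
          refine Finset.prod_le_prod' fun j _ => ?_
          by_cases h1 : j = t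
          · subst h1
            simp only [true_or, if_true, htk, if_false, mul_one]
            exact smoothed_le hδ hgm hg (by norm_num) hg8 _
          by_cases h2 : j = k
          · subst h2
            simp only [h1, or_true, if_true, if_false, one_mul]
            exact le_rfl
          · simpa [h1, h2] using lintegral_normalDensity_le_one _ _
      _ = _ := by simp only [Finset.prod_mul_distrib]; simp
  have hsm : Measurable fun x => smoothed δ g (x + b k) :=
    (measurable_smoothed hgm).comp (by fun_prop)
  obtain ⟨e1, e2, e3⟩ := hbound phi c hphi hc k hk (fun x => smoothed δ g (x + b k)) (m * 8) 8 hsm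
    (fun x => smoothed_le hδ hgm hg (by norm_num) hg8 _)
    (mul_le_of_le_one_left' (by simp [hm]))
    (by rw [lintegral_add_right_eq_self]; exact (lintegral_smoothed_le hgm).trans hg8)
  have hker : Measurable fun θ : Fin (I.T + 1) → ℝ =>
      ∏ j : Fin I.T, abilityKernel C I phi c j (θ j.castSucc) (θ j.succ) :=
    Finset.measurable_fun_prod _ fun j _ => (measurable_abilityKernel C I phi c j).comp
      (f := fun θ : Fin (I.T + 1) → ℝ => (θ j.castSucc, θ j.succ)) (by fun_prop)
  have hmeas : Measurable fun θ : Fin (I.T + 1) → ℝ => (.ofReal (normalDensity I.mu I.V (θ 0)) *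
      ∏ j : Fin I.T, abilityKernel C I phi c j (θ j.castSucc) (θ j.succ)) *
      smoothed δ g (θ k.succ + b k) :=
    (Measurable.mul (by fun_prop) hker).mul (hsm.comp (measurable_pi_apply _))
  have hE := le_mul_of_le_of_le_of_le_interpolate e1 e2 e3
  calc _ ≤ ∫⁻ θ : Fin (I.T + 1) → ℝ, (m * 8) * ((.ofReal (normalDensity I.mu I.V (θ 0)) *
          ∏ j : Fin I.T, abilityKernel C I phi c j (θ j.castSucc) (θ j.succ)) *
        smoothed δ g (θ k.succ + b k)) := lintegral_mono hday
    _ = (m * 8) * abilityMean C I phi c k (fun x => smoothed δ g (x + b k)) :=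
        lintegral_const_mul _ hmeas
    _ ≤ (m * 8) * (m ^ (1 / 8 : ℝ) * ENNReal.ofReal (K * (min 1 √phi * (1 + c)⁻¹)) ^ (5 / 8 : ℝ) *
          ENNReal.ofReal (K * (1 + c)⁻¹ ^ 2) ^ (1 / 4 : ℝ) * 8) := by gcongr
    _ = _ := by
        rw [ENNReal.ofReal_mul hK.le, ENNReal.ofReal_mul (by positivity),
          ENNReal.ofReal_mul hK.le, ENNReal.ofReal_pow (by positivity), ← hr,
          ENNReal.mul_rpow_of_nonneg _ _ (by norm_num), ENNReal.mul_rpow_of_nonneg _ _ (by norm_num),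
          ENNReal.mul_rpow_of_nonneg _ _ (by norm_num), ← ENNReal.rpow_natCast, ← ENNReal.rpow_mul,
          -- The exponent 9/8 arises as 5/8 + 2/4 for `(1 + c)⁻¹` and as 1 + 1/8 for `min 1 √δ`.
          show (9 / 8 : ℝ) = 5 / 8 + (2 : ℕ) * (1 / 4) by norm_num,
          ENNReal.rpow_add_of_nonneg (x := r) _ _ (by norm_num) (by norm_num),
          show (5 / 8 + (2 : ℕ) * (1 / 4) : ℝ) = 1 + 1 / 8 by norm_num,
          ENNReal.rpow_add_of_nonneg (x := m) _ _ (by norm_num) (by norm_num), ENNReal.rpow_one]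
        ring

theorem measurable_predictor (I : Individual) (t : Fin I.T) (s : Fin (I.S t)) :
    Measurable fun p : BaseParams I => predictor I p t s := by
  have h : Measurable fun p : BaseParams I => testEffect (p.2.2.2.2.2 t) s :=
    (measurable_testEffect s).comp (f := fun p : BaseParams I => p.2.2.2.2.2 t) (by fun_prop)
  change Measurable fun p : BaseParams I =>
    p.1 t.succ - I.a t s + p.2.2.2.2.1 t + testEffect (p.2.2.2.2.2 t) s
  fun_prop

theorem measurable_baseDensity (C : Constants) (I : Individual) :
    Measurable fun z : ℝ × BaseParams I => baseDensity C I z.1 z.2 := by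
  have h : ∀ t : Fin I.T, Measurable fun z : ℝ × BaseParams I =>
      testEffectDensity z.2.2.2.2.1 (z.2.2.2.2.2.2 t) := fun t =>
    measurable_testEffectDensity.comp
      (f := fun z : ℝ × BaseParams I => (z.2.2.2.2.1, z.2.2.2.2.2.2 t)) (by fun_prop)
  have h' := Finset.measurable_fun_prod Finset.univ fun t _ => h t
  unfold baseDensity
  fun_prop

/-- The likelihood of one individual's responses, with all item parameters integrated out. -/
noncomputable def responseLikelihood (R : Bool → ℝ → ℝ≥0∞) (I : Individual) (p : BaseParams I) :
    ℝ≥0∞ :=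
  ∏ t, ∏ s, ∏ l, R (I.X t s l) (predictor I p t s)

theorem measurable_responseLikelihood {R : Bool → ℝ → ℝ≥0∞} (hR : ∀ x, Measurable (R x))
    (I : Individual) : Measurable (responseLikelihood R I) := by
  unfold responseLikelihood
  exact Finset.measurable_fun_prod _ fun t _ => Finset.measurable_fun_prod _ fun s _ =>
    Finset.measurable_fun_prod _ fun l _ => (hR _).comp (measurable_predictor I t s)

/-- Gives selected and unselected days one common form, so that the bounds of all days can be chosen
at once and multiplied. -/
theorem ResponseBound.exists_day_bound {R : Bool → ℝ → ℝ≥0∞} {K : ℝ≥0∞} (hR : ResponseBound R K)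
    (I : Individual) (j : Fin I.T) (P : Prop) [Decidable P] (h : P → I.InformativeDay j) :
    ∃ (w : (Fin (I.S j - 1) → ℝ) → ℝ≥0∞) (b : (Fin (I.S j - 1) → ℝ) → ℝ),
      Measurable w ∧ (∀ η, w η ≠ ∞) ∧ Measurable b ∧
      (∀ tau, 0 < tau → ∫⁻ η, .ofReal (testEffectDensity tau η) * w η ≤
        if P then 8 * .ofReal (min 1 √tau) else 1) ∧
      ∀ (x d : ℝ) (η : Fin (I.S j - 1) → ℝ),
        ∏ s, ∏ l, R (I.X j s l) (x - I.a j s + d + testEffect η s) ≤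
          (∏ s, K ^ I.K j s) *
            (w η * if P then .ofReal (Real.exp (-(|x + b η + d| / 4))) else 1) := by
  by_cases hP : P
  · obtain ⟨w, b, hw, hw', hb, h1, h2⟩ := hR.exists_informativeDay_bound (h hP)
    refine ⟨w, b, hw, hw', hb, by simpa [hP] using h1, fun x d η => ?_⟩
    simpa [hP, add_right_comm] using h2 x d η
  · refine ⟨fun _ => 1, fun _ => 0, measurable_const, fun _ => ENNReal.one_ne_top,
      measurable_const, fun tau htau => ?_, fun x d η => ?_⟩
    · simpa [hP] using lintegral_testEffectDensity_le_one htau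
    · simp only [hP, if_false, mul_one]
      refine Finset.prod_le_prod' fun s _ => ?_
      refine (Finset.prod_le_pow_card _ _ K fun l _ => hR.le _ _).trans ?_
      simp

/-- The likelihood is dominated by a weight in the test effects times localizations of ability plus
daily effect. The bound for the inner integral is uniform in the shifts `b j (η j)`, so the
integrals over `τ`, `δ` and `c` separate, each with exponent above 1. -/
theorem ResponseBound.exists_lintegral_base_le {R : Bool → ℝ → ℝ≥0∞} {K : ℝ≥0∞}
    (hR : ResponseBound R K) (C : Constants) (I : Individual) (hrho : C.rho ≠ 0)
    (hmax : 0 < C.maxLapse) (hlapse : ∀ t, 0 < I.lapse t) (hV : 0 < I.V)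
    (hdays : ∃ t t', t ≠ t' ∧ I.InformativeDay t ∧ I.InformativeDay t') :
    ∃ B : ℝ≥0∞, B ≠ ∞ ∧ ∀ phi : ℝ, 0 < phi →
      ∫⁻ p, .ofReal (baseDensity C I phi p) * responseLikelihood R I p ≤
        B * .ofReal (min 1 √phi) ^ (5 / 8 : ℝ) := by
  -- Of two distinct days at most one has index 0, so `k` can be preceded by at least two
  -- transitions.
  obtain ⟨t, k, htk, ht, hk, hk1⟩ : ∃ t k : Fin I.T, t ≠ k ∧ I.InformativeDay t ∧
      I.InformativeDay k ∧ 1 ≤ (k : ℕ) := by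
    obtain ⟨t, k, htk, ht, hk⟩ := hdays
    by_cases h : 1 ≤ (k : ℕ)
    · exact ⟨t, k, htk, ht, hk, h⟩
    · refine ⟨k, t, htk.symm, hk, ht, ?_⟩
      have : (t : ℕ) ≠ k := fun e => htk (Fin.ext e)
      omega
  have hday := fun j : Fin I.T => hR.exists_day_bound I j (j = t ∨ j = k) (by
    rintro (rfl | rfl) <;> assumption)
  choose w b hw hwtop hb hint hle using hday
  set g : ℝ → ℝ≥0∞ := fun x => .ofReal (Real.exp (-(|x| / 4))) with hg
  obtain ⟨B, hB, hbound⟩ := exists_lintegral_abilities_le C I hrho hmax hlapse hV htk hk1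
    (g := g) (by fun_prop)
    (fun x => by
      rw [hg, ENNReal.ofReal_le_one, Real.exp_le_one_iff]
      linarith [abs_nonneg x])
    (by simpa [hg] using lintegral_exp_neg_abs_affine_le le_rfl 0)
  set Kall : ℝ≥0∞ := ∏ j, ∏ s, K ^ I.K j s with hKall
  have hKtop : Kall ≠ ∞ := ENNReal.prod_ne_top fun j _ => ENNReal.prod_ne_top fun s _ =>
    ENNReal.pow_ne_top hR.ne_top
  set I1 := ∫⁻ c, .ofReal (growthPrior c) * .ofReal (1 + c)⁻¹ ^ (9 / 8 : ℝ) with hI1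
  set I2 := ∫⁻ x, .ofReal (precisionPrior x) * .ofReal (min 1 √x) ^ (9 / 8 : ℝ) with hI2
  set I3 := ∫⁻ x, .ofReal (precisionPrior x) * .ofReal (min 1 √x) ^ (2 : ℝ) with hI3
  refine ⟨Kall * B * 64 * I1 * I2 * I3, ?_, ?_⟩
  · have h1 : I1 ≠ ∞ := (lintegral_growthPrior_lt_top (by norm_num)).ne
    have h2 : I2 ≠ ∞ := (lintegral_precisionPrior_lt_top (by norm_num)).ne
    have h3 : I3 ≠ ∞ := (lintegral_precisionPrior_lt_top (by norm_num)).ne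
    exact ENNReal.mul_ne_top (ENNReal.mul_ne_top (ENNReal.mul_ne_top (ENNReal.mul_ne_top
      (ENNReal.mul_ne_top hKtop hB) (by norm_num)) h1) h2) h3
  intro phi hphi
  have hF : Measurable fun p : BaseParams I =>
      ENNReal.ofReal (baseDensity C I phi p) * responseLikelihood R I p := by
    refine Measurable.mul ?_ (measurable_responseLikelihood hR.meas I)
    exact ((measurable_baseDensity C I).comp (measurable_const.prodMk measurable_id)).ennreal_ofReal
  rw [lintegral_prod_six hF]
  have hlik : ∀ θ c δ τ day η, responseLikelihood R I (θ, c, δ, τ, day, η) ≤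
      Kall * (∏ j, w j (η j)) *
        ∏ j, (if j = t ∨ j = k then g (θ j.succ + b j (η j) + day j) else 1) := by
    intro θ c δ τ day η
    simp only [hKall, ← Finset.prod_mul_distrib, mul_assoc]
    exact Finset.prod_le_prod' fun j _ => hle j _ _ _
  set A := ENNReal.ofReal (min 1 √phi) ^ (5 / 8 : ℝ) with hA
  have hinner : ∀ (c δ τ : ℝ) (η : (j : Fin I.T) → Fin (I.S j - 1) → ℝ),
      ∫⁻ θ, ∫⁻ day, ENNReal.ofReal (baseDensity C I phi (θ, c, δ, τ, day, η)) *
        responseLikelihood R I (θ, c, δ, τ, day, η) ≤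
      (ENNReal.ofReal (growthPrior c) * .ofReal (precisionPrior δ) * .ofReal (precisionPrior τ) *
        Kall * ∏ j, (ENNReal.ofReal (testEffectDensity τ (η j)) * w j (η j))) *
        (B * A * .ofReal (1 + c)⁻¹ ^ (9 / 8 : ℝ) * .ofReal (min 1 √δ) ^ (9 / 8 : ℝ)) := by
    intro c δ τ η
    set M := ENNReal.ofReal (growthPrior c) * .ofReal (precisionPrior δ) *
      .ofReal (precisionPrior τ) * Kall *
      ∏ j, (ENNReal.ofReal (testEffectDensity τ (η j)) * w j (η j)) with hM
    have hMtop : M ≠ ∞ := by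
      refine ENNReal.mul_ne_top (ENNReal.mul_ne_top (ENNReal.mul_ne_top (ENNReal.mul_ne_top
        ?_ ?_) ?_) hKtop) (ENNReal.prod_ne_top fun j _ => ENNReal.mul_ne_top ?_ (hwtop _ _)) <;>
      exact ENNReal.ofReal_ne_top
    calc _ ≤ ∫⁻ θ : Fin (I.T + 1) → ℝ, ∫⁻ day : Fin I.T → ℝ, M *
          ((.ofReal (normalDensity I.mu I.V (θ 0)) *
            ∏ j : Fin I.T, abilityKernel C I phi c j (θ j.castSucc) (θ j.succ)) *
          ∏ j, (.ofReal (normalDensity 0 (1 / δ) (day j)) *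
            (if j = t ∨ j = k then g (θ j.succ + b j (η j) + day j) else 1))) := by
          refine lintegral_mono fun θ => lintegral_mono fun day => ?_
          rw [ofReal_baseDensity]
          refine (mul_le_mul_right (hlik θ c δ τ day η) _).trans (le_of_eq ?_)
          simp only [hM, Finset.prod_mul_distrib]
          ring
      _ = M * ∫⁻ θ : Fin (I.T + 1) → ℝ, ∫⁻ day : Fin I.T → ℝ,
          ((.ofReal (normalDensity I.mu I.V (θ 0)) *
            ∏ j : Fin I.T, abilityKernel C I phi c j (θ j.castSucc) (θ j.succ)) *
          ∏ j, (.ofReal (normalDensity 0 (1 / δ) (day j)) *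
            (if j = t ∨ j = k then g (θ j.succ + b j (η j) + day j) else 1))) := by
          simp only [lintegral_const_mul' _ _ hMtop]
      _ ≤ _ := by
          -- Outside the positive range the prior factor in `M` vanishes.
          by_cases hc : 0 < c
          · by_cases hδ : 0 < δ
            · gcongr
              exact hbound phi c δ hphi hc hδ fun j => b j (η j)
            · simp [hM, precisionPrior, hδ]
          · simp [hM, growthPrior, hc]
  have hη : ∀ c δ τ : ℝ, ∫⁻ η, ∫⁻ θ, ∫⁻ day,
      ENNReal.ofReal (baseDensity C I phi (θ, c, δ, τ, day, η)) *
        responseLikelihood R I (θ, c, δ, τ, day, η) ≤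
      (Kall * B * 64 * A) * ((ENNReal.ofReal (growthPrior c) * .ofReal (1 + c)⁻¹ ^ (9 / 8 : ℝ)) *
        ((ENNReal.ofReal (precisionPrior δ) * .ofReal (min 1 √δ) ^ (9 / 8 : ℝ)) *
        (ENNReal.ofReal (precisionPrior τ) * .ofReal (min 1 √τ) ^ (2 : ℝ)))) := by
    intro c δ τ
    refine (lintegral_mono (hinner c δ τ)).trans ?_
    by_cases hτ : 0 < τ
    swap
    · simp [precisionPrior, hτ]
    have htm : ∀ j : Fin I.T, Measurable fun x : Fin (I.S j - 1) → ℝ =>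
        ENNReal.ofReal (testEffectDensity τ x) * w j x := fun j =>
      Measurable.mul ((measurable_testEffectDensity.comp
        (measurable_const.prodMk measurable_id)).ennreal_ofReal) (hw j)
    have hpm : Measurable fun η : (j : Fin I.T) → Fin (I.S j - 1) → ℝ =>
        ∏ j, (ENNReal.ofReal (testEffectDensity τ (η j)) * w j (η j)) :=
      Finset.measurable_fun_prod _ fun j _ => (htm j).comp (measurable_pi_apply j)
    have hprod : ∫⁻ η : (j : Fin I.T) → Fin (I.S j - 1) → ℝ,
        ∏ j, (ENNReal.ofReal (testEffectDensity τ (η j)) * w j (η j)) ≤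
        64 * .ofReal (min 1 √τ) ^ (2 : ℝ) := by
      rw [lintegral_fin_prod htm]
      calc _ ≤ ∏ j, (if j = t then 8 * ENNReal.ofReal (min 1 √τ) else 1) *
            (if j = k then 8 * ENNReal.ofReal (min 1 √τ) else 1) := by
            refine Finset.prod_le_prod' fun j _ => (hint j τ hτ).trans ?_
            by_cases h1 : j = t
            · subst h1; simp [htk]
            · simp [h1]
        _ = 8 * ENNReal.ofReal (min 1 √τ) * (8 * ENNReal.ofReal (min 1 √τ)) := by
            simp only [Finset.prod_mul_distrib]; simp
        _ = _ := by rw [ENNReal.rpow_two]; ring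
    rw [lintegral_mul_const _ (hpm.const_mul _), lintegral_const_mul _ hpm]
    calc _ ≤ (ENNReal.ofReal (growthPrior c) * .ofReal (precisionPrior δ) *
          .ofReal (precisionPrior τ) * Kall * (64 * .ofReal (min 1 √τ) ^ (2 : ℝ))) *
          (B * A * .ofReal (1 + c)⁻¹ ^ (9 / 8 : ℝ) * .ofReal (min 1 √δ) ^ (9 / 8 : ℝ)) := by gcongr
      _ = _ := by ring
  have hm : ∀ r : ℝ, Measurable fun x : ℝ =>
      ENNReal.ofReal (precisionPrior x) * .ofReal (min 1 √x) ^ r := fun r => by fun_prop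
  calc _ ≤ ∫⁻ c, ∫⁻ δ, ∫⁻ τ, (Kall * B * 64 * A) *
        ((ENNReal.ofReal (growthPrior c) * .ofReal (1 + c)⁻¹ ^ (9 / 8 : ℝ)) *
        ((ENNReal.ofReal (precisionPrior δ) * .ofReal (min 1 √δ) ^ (9 / 8 : ℝ)) *
        (ENNReal.ofReal (precisionPrior τ) * .ofReal (min 1 √τ) ^ (2 : ℝ)))) := by
        gcongr with c δ τ
        exact hη c δ τ
    _ = Kall * B * 64 * A * (I1 * (I2 * I3)) := by
        have e1 : ∀ c δ, ∫⁻ τ, (Kall * B * 64 * A) *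
          ((ENNReal.ofReal (growthPrior c) * .ofReal (1 + c)⁻¹ ^ (9 / 8 : ℝ)) *
          ((ENNReal.ofReal (precisionPrior δ) * .ofReal (min 1 √δ) ^ (9 / 8 : ℝ)) *
          (ENNReal.ofReal (precisionPrior τ) * .ofReal (min 1 √τ) ^ (2 : ℝ)))) =
          (Kall * B * 64 * A) *
          ((ENNReal.ofReal (growthPrior c) * .ofReal (1 + c)⁻¹ ^ (9 / 8 : ℝ)) *
          ((ENNReal.ofReal (precisionPrior δ) * .ofReal (min 1 √δ) ^ (9 / 8 : ℝ)) * I3)) := by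
          intro c δ
          rw [lintegral_const_mul _ (((hm 2).const_mul _).const_mul _),
            lintegral_const_mul _ ((hm 2).const_mul _), lintegral_const_mul _ (hm 2)]
        simp only [e1]
        have e2 : ∀ c, ∫⁻ δ, (Kall * B * 64 * A) *
          ((ENNReal.ofReal (growthPrior c) * .ofReal (1 + c)⁻¹ ^ (9 / 8 : ℝ)) *
          ((ENNReal.ofReal (precisionPrior δ) * .ofReal (min 1 √δ) ^ (9 / 8 : ℝ)) * I3)) =
          (Kall * B * 64 * A) *
          ((ENNReal.ofReal (growthPrior c) * .ofReal (1 + c)⁻¹ ^ (9 / 8 : ℝ)) * (I2 * I3)) := by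
          intro c
          rw [lintegral_const_mul _ (((hm _).mul_const _).const_mul _),
            lintegral_const_mul _ ((hm _).mul_const _), lintegral_mul_const _ (hm _)]
        simp only [e2]
        rw [lintegral_const_mul _ (by fun_prop), lintegral_mul_const _ (by fun_prop)]
    _ = _ := by ring

/-! ### Integrating out the item parameters -/

/-- Completing the square: exponential tilting shifts the mean by `lam * v`. -/
theorem normalDensity_mul_exp {v : ℝ} (hv : 0 < v) (m lam y : ℝ) :
    normalDensity m v y * Real.exp (lam * y) =
      Real.exp (lam * m + lam ^ 2 * v / 2) * normalDensity (m + lam * v) v y := by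
  rw [normalDensity_eq hv.le, normalDensity_eq hv.le, mul_assoc, mul_left_comm (Real.exp _),
    ← Real.exp_add, ← Real.exp_add]
  congr 2
  field_simp
  ring

theorem lintegral_normalDensity_mul_exp {v : ℝ} (hv : 0 < v) (m lam : ℝ) :
    ∫⁻ y, .ofReal (normalDensity m v y * Real.exp (lam * y)) =
      .ofReal (Real.exp (lam * m + lam ^ 2 * v / 2)) := by
  simp only [normalDensity_mul_exp hv, ENNReal.ofReal_mul (Real.exp_pos _).le]
  rw [lintegral_const_mul _ (by fun_prop), lintegral_normalDensity hv, mul_one]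

theorem responseProb_pos (x : Bool) (u : ℝ) : 0 < responseProb x u := by
  have := Real.exp_pos u
  unfold responseProb
  split_ifs
  · positivity
  · rw [sub_pos, div_lt_one (by positivity)]; linarith

theorem responseProb_le_one (x : Bool) (u : ℝ) : responseProb x u ≤ 1 := by
  have := Real.exp_pos u
  unfold responseProb
  split_ifs
  · rw [div_le_one (by positivity)]; linarith
  · have : 0 ≤ Real.exp u / (1 + Real.exp u) := by positivity
    linarith

/-- With `z = exp (u / 2)` this is `z ^ 2 ≤ z * (1 + z ^ 2)`. -/
theorem responseProb_true_le (u : ℝ) : responseProb true u ≤ Real.exp (1 / 2 * u) := by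
  have h : Real.exp u = Real.exp (1 / 2 * u) * Real.exp (1 / 2 * u) := by
    rw [← Real.exp_add]; ring_nf
  have := Real.exp_pos (1 / 2 * u)
  simp only [responseProb, if_true]
  rw [h, div_le_iff₀ (by positivity)]
  nlinarith [mul_nonneg this.le (sq_nonneg (Real.exp (1 / 2 * u) - 1))]

theorem responseProb_false_le (u : ℝ) : responseProb false u ≤ Real.exp (-1 / 2 * u) := by
  have h : Real.exp u = Real.exp (1 / 2 * u) * Real.exp (1 / 2 * u) := by
    rw [← Real.exp_add]; ring_nf
  have h' : Real.exp (-1 / 2 * u) = (Real.exp (1 / 2 * u))⁻¹ := by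
    rw [← Real.exp_neg]; ring_nf
  have hp := Real.exp_pos (1 / 2 * u)
  have e : responseProb false u = (1 + Real.exp u)⁻¹ := by
    have := Real.exp_pos u
    simp only [responseProb, Bool.false_eq_true, if_false]
    field_simp
    ring
  rw [e, h', h]
  gcongr
  nlinarith [sq_nonneg (Real.exp (1 / 2 * u) - 1)]

@[fun_prop]
theorem measurable_responseProb (x : Bool) : Measurable (responseProb x) := by
  unfold responseProb
  split_ifs <;> fun_prop

theorem signIndicator_nonneg (x : Bool) (y : ℝ) : 0 ≤ signIndicator x y := by
  unfold signIndicator; split_ifs <;> simp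

theorem signIndicator_le_one (x : Bool) (y : ℝ) : signIndicator x y ≤ 1 := by
  unfold signIndicator; split_ifs <;> simp

theorem signIndicator_true_le (y : ℝ) : signIndicator true y ≤ Real.exp (1 / 2 * y) := by
  rcases lt_or_ge 0 y with h | h
  · simpa [signIndicator, h, h.not_ge] using h.le
  · simp [signIndicator, h.not_gt, Real.exp_nonneg]

theorem signIndicator_false_le (y : ℝ) : signIndicator false y ≤ Real.exp (-1 / 2 * y) := by
  rcases lt_or_ge 0 y with h | h
  · simp [signIndicator, h.not_ge, Real.exp_nonneg]
  · simpa [signIndicator, h] using by linarith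

@[fun_prop]
theorem measurable_signIndicator (x : Bool) : Measurable (signIndicator x) := by
  cases x
  · have : signIndicator false = fun y => if y ≤ 0 then 1 else 0 := by ext; simp [signIndicator]
    rw [this]
    exact Measurable.ite measurableSet_Iic measurable_const measurable_const
  · have : signIndicator true = fun y => if 0 < y then 1 else 0 := by ext; simp [signIndicator]
    rw [this]
    exact Measurable.ite measurableSet_Ioi measurable_const measurable_const

/-- The probability of a response given the predictor. -/
noncomputable def responseMean (C : Constants) (x : Bool) (v : ℝ) : ℝ≥0∞ :=
  ∫⁻ e, .ofReal (normalDensity 0 (C.sigma ^ 2) e * responseProb x (v + e))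

/-- The bounds `exp (± u / 2)` on the logistic probabilities reduce everything to the Gaussian
moment generating function at `± 1/2`, whence `exp (σ ^ 2 / 8)`. -/
theorem responseBound_responseMean (C : Constants) (hsigma : 0 < C.sigma) :
    ResponseBound (responseMean C) (.ofReal (Real.exp (C.sigma ^ 2 / 8))) := by
  have hv : 0 < C.sigma ^ 2 := by positivity
  have hone : 1 ≤ ENNReal.ofReal (Real.exp (C.sigma ^ 2 / 8)) := by
    rw [ENNReal.one_le_ofReal]; exact Real.one_le_exp (by positivity)
  have key : ∀ (x : Bool) (lam v : ℝ), (∀ u, responseProb x u ≤ Real.exp (lam * u)) →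
      lam ^ 2 = 1 / 4 →
      responseMean C x v ≤ .ofReal (Real.exp (C.sigma ^ 2 / 8)) * .ofReal (Real.exp (lam * v)) := by
    intro x lam v h hlam
    calc responseMean C x v ≤ ∫⁻ e, .ofReal (Real.exp (lam * v)) *
          .ofReal (normalDensity 0 (C.sigma ^ 2) e * Real.exp (lam * e)) := by
          refine lintegral_mono fun e => ?_
          rw [← ENNReal.ofReal_mul (Real.exp_pos _).le, mul_left_comm, ← Real.exp_add, ← mul_add]
          have := normalDensity_nonneg 0 (C.sigma ^ 2) e
          gcongr
          exact h _
      _ = _ := by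
          rw [lintegral_const_mul _ (by fun_prop), lintegral_normalDensity_mul_exp hv, hlam, mul_comm]
          ring_nf
  refine ⟨fun x => ?_, hone, ENNReal.ofReal_ne_top, fun x v => ?_, fun v => ?_, fun v => ?_⟩
  · exact Measurable.lintegral_prod_right' (ν := volume) (f := fun z : ℝ × ℝ =>
      ENNReal.ofReal (normalDensity 0 (C.sigma ^ 2) z.2 * responseProb x (z.1 + z.2))) (by fun_prop)
  · refine le_trans ?_ hone
    simp only [responseMean, ENNReal.ofReal_mul (normalDensity_nonneg _ _ _)]
    exact lintegral_normalDensity_mul_le_sup _ _ fun e => by simpa using responseProb_le_one x _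
  · convert key true (1 / 2) v responseProb_true_le (by norm_num) using 4
    ring
  · convert key false (-1 / 2) v responseProb_false_le (by norm_num) using 4
    ring

/-- The probability of a response given the predictor, in terms of the latent variables. -/
noncomputable def augResponseMean (C : Constants) (x : Bool) (v : ℝ) : ℝ≥0∞ :=
  ∫⁻ nu, ∫⁻ y, .ofReal (ksDensity nu * signIndicator x y *
    normalDensity v (4 * nu ^ 2 + C.sigma ^ 2) y)

attribute [fun_prop] measurable_ksDensity

/-- A Chernoff bound: the sign indicators are at most `exp (± y / 2)`, and variance `4 ν ^ 2 + σ ^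
2` produces `exp (ν ^ 2 / 2 + σ ^ 2 / 8)`, integrable against the density of `ν`. The summand 1 in
the constant secures `one_le`. -/
theorem responseBound_augResponseMean (C : Constants) (hsigma : 0 < C.sigma) :
    ResponseBound (augResponseMean C) (1 + .ofReal (Real.exp (C.sigma ^ 2 / 8)) *
      ∫⁻ x, .ofReal (ksDensity x * Real.exp (x ^ 2 / 2))) := by
  have hone : 1 ≤ ENNReal.ofReal (Real.exp (C.sigma ^ 2 / 8)) := by
    rw [ENNReal.one_le_ofReal]; exact Real.one_le_exp (by positivity)
  have key : ∀ (x : Bool) (lam v : ℝ), (∀ u, signIndicator x u ≤ Real.exp (lam * u)) →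
      (∀ nu : ℝ, lam ^ 2 * (4 * nu ^ 2 + C.sigma ^ 2) / 2 ≤ nu ^ 2 / 2 + C.sigma ^ 2 / 8) →
      augResponseMean C x v ≤ (1 + .ofReal (Real.exp (C.sigma ^ 2 / 8)) *
        ∫⁻ x, .ofReal (ksDensity x * Real.exp (x ^ 2 / 2))) * .ofReal (Real.exp (lam * v)) := by
    intro x lam v h hlam
    refine le_trans ?_ (mul_le_mul_left le_add_self _)
    rw [mul_right_comm, ← lintegral_const_mul _ (by fun_prop)]
    refine lintegral_mono fun nu => ?_
    have hv : 0 < 4 * nu ^ 2 + C.sigma ^ 2 := by positivity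
    have hk := ksDensity_nonneg nu
    calc _ ≤ ∫⁻ y, .ofReal (ksDensity nu) *
          .ofReal (normalDensity v (4 * nu ^ 2 + C.sigma ^ 2) y * Real.exp (lam * y)) := by
          refine lintegral_mono fun y => ?_
          rw [← ENNReal.ofReal_mul hk, mul_assoc, mul_comm (signIndicator x y)]
          have := normalDensity_nonneg v (4 * nu ^ 2 + C.sigma ^ 2) y
          gcongr
          exact h y
      _ = .ofReal (ksDensity nu) *
          .ofReal (Real.exp (lam * v + lam ^ 2 * (4 * nu ^ 2 + C.sigma ^ 2) / 2)) := by
          rw [lintegral_const_mul _ (by fun_prop), lintegral_normalDensity_mul_exp hv]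
      _ ≤ .ofReal (ksDensity nu) *
          .ofReal (Real.exp (lam * v + (nu ^ 2 / 2 + C.sigma ^ 2 / 8))) := by
          gcongr
          exact hlam nu
      _ = _ := by
          rw [Real.exp_add, Real.exp_add, ENNReal.ofReal_mul (Real.exp_pos _).le,
            ENNReal.ofReal_mul (Real.exp_pos _).le, ENNReal.ofReal_mul hk]
          ring
  refine ⟨fun x => ?_, le_self_add, ENNReal.add_ne_top.2 ⟨ENNReal.one_ne_top, ENNReal.mul_ne_top
    ENNReal.ofReal_ne_top lintegral_ksDensity_mul_exp_lt_top.ne⟩, fun x v => ?_, fun v => ?_,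
    fun v => ?_⟩
  · have h1 : Measurable fun z : ℝ × ℝ => ∫⁻ y, ENNReal.ofReal (ksDensity z.2 * signIndicator x y *
        normalDensity z.1 (4 * z.2 ^ 2 + C.sigma ^ 2) y) :=
      Measurable.lintegral_prod_right' (ν := volume) (f := fun z : (ℝ × ℝ) × ℝ =>
        ENNReal.ofReal (ksDensity z.1.2 * signIndicator x z.2 *
          normalDensity z.1.1 (4 * z.1.2 ^ 2 + C.sigma ^ 2) z.2)) (by fun_prop)
    exact Measurable.lintegral_prod_right' (ν := volume) h1
  -- Exponent 0 in the same estimate gives the bound uniform in `v`.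
  · have h := key x 0 v (fun u => by simpa using signIndicator_le_one x u)
      (fun nu => by have := sq_nonneg nu; have := sq_nonneg C.sigma; simp; positivity)
    simpa using h
  · convert key true (1 / 2) v signIndicator_true_le (fun nu => by linarith) using 4
    ring
  · convert key false (-1 / 2) v signIndicator_false_le (fun nu => by linarith) using 4
    ring

theorem lintegral_itemFamily_prod (I : Individual)
    {f : (t : Fin I.T) → (s : Fin (I.S t)) → Fin (I.K t s) → ℝ → ℝ≥0∞}
    (hf : ∀ t s l, Measurable (f t s l)) :
    ∫⁻ z : ItemFamily I, ∏ t, ∏ s, ∏ l, f t s l (z t s l) = ∏ t, ∏ s, ∏ l, ∫⁻ x, f t s l x := by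
  have h1 : ∀ t s, Measurable fun z : Fin (I.K t s) → ℝ => ∏ l, f t s l (z l) := fun t s =>
    Finset.measurable_fun_prod _ fun l _ => (hf t s l).comp (measurable_pi_apply l)
  have h2 : ∀ t, Measurable fun z : (s : Fin (I.S t)) → Fin (I.K t s) → ℝ =>
      ∏ s, ∏ l, f t s l (z s l) := fun t =>
    Finset.measurable_fun_prod _ fun s _ => (h1 t s).comp (measurable_pi_apply s)
  rw [lintegral_fin_prod h2]
  refine Finset.prod_congr rfl fun t _ => ?_
  rw [lintegral_fin_prod (h1 t)]
  exact Finset.prod_congr rfl fun s _ => lintegral_fin_prod (hf t s)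

/-! ### The joint posterior -/

theorem baseDensity_nonneg (C : Constants) (I : Individual) (phi : ℝ) (p : BaseParams I) :
    0 ≤ baseDensity C I phi p := by
  obtain ⟨θ, c, δ, τ, day, η⟩ := p
  have hn : ∀ m v x, 0 ≤ normalDensity m v x := normalDensity_nonneg
  have hg := growthPrior_nonneg c
  have hp := precisionPrior_nonneg
  rcases le_or_gt τ 0 with hτ | hτ
  · simp [baseDensity, precisionPrior, hτ.not_gt]
  · exact mul_nonneg (mul_nonneg (mul_nonneg (mul_nonneg (mul_nonneg (mul_nonneg (hn _ _ _) hg)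
      (hp δ)) (hp τ)) (Finset.prod_nonneg fun _ _ => hn _ _ _))
      (Finset.prod_nonneg fun _ _ => hn _ _ _))
      (Finset.prod_nonneg fun _ _ => (testEffectDensity_pos hτ _).le)

theorem baseDensity_pos {C : Constants} {I : Individual} (hlapse : ∀ t, 0 < I.lapse t)
    (hV : 0 < I.V) {phi : ℝ} (hphi : 0 < phi) {p : BaseParams I} (hc : 0 < p.2.1)
    (hδ : 0 < p.2.2.1) (hτ : 0 < p.2.2.2.1) : 0 < baseDensity C I phi p := by
  obtain ⟨θ, c, δ, τ, day, η⟩ := p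
  simp only at hc hδ hτ
  have h1 : 0 < growthPrior c := by simp [growthPrior, hc]
  have h2 : ∀ x, 0 < x → 0 < precisionPrior x := fun x hx => by
    rw [precisionPrior, if_pos hx]; positivity
  exact mul_pos (mul_pos (mul_pos (mul_pos (mul_pos (mul_pos (normalDensity_pos hV _ _) h1)
    (h2 _ hδ)) (h2 _ hτ)) (Finset.prod_pos fun t _ => normalDensity_pos (div_pos (hlapse t) hphi) _ _))
    (Finset.prod_pos fun _ _ => normalDensity_pos (by positivity) _ _))
    (Finset.prod_pos fun _ _ => testEffectDensity_pos hτ _)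

/-- Given `φ` the individuals are independent, so their bounds multiply to `min 1 √φ ^ (5 n / 8)`;
only here is `n ≥ 2` needed, to push the exponent above 1. -/
theorem ResponseBound.lintegral_joint_lt_top {R : Bool → ℝ → ℝ≥0∞} {K : ℝ≥0∞}
    (hR : ResponseBound R K) {n : ℕ} (hn : 2 ≤ n) (C : Constants) (I : Fin n → Individual)
    (hrho : C.rho ≠ 0) (hmax : 0 < C.maxLapse) (hlapse : ∀ i t, 0 < (I i).lapse t)
    (hV : ∀ i, 0 < (I i).V)
    (hdays : ∀ i, ∃ t t', t ≠ t' ∧ (I i).InformativeDay t ∧ (I i).InformativeDay t')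
    {Z : Fin n → Type} [∀ i, MeasureSpace (Z i)] [∀ i, SigmaFinite (volume : Measure (Z i))]
    {q : ∀ i, BaseParams (I i) × Z i → ℝ≥0∞} (hq : ∀ i, Measurable (q i))
    (hqR : ∀ i p, ∫⁻ z, q i (p, z) = responseLikelihood R (I i) p) :
    ∫⁻ w : ℝ × ((i : Fin n) → BaseParams (I i) × Z i), .ofReal (precisionPrior w.1) *
      ∏ i, (.ofReal (baseDensity C (I i) w.1 (w.2 i).1) * q i (w.2 i)) < ∞ := by
  choose B hB hbound using fun i =>
    hR.exists_lintegral_base_le C (I i) hrho hmax (hlapse i) (hV i) (hdays i)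
  have hm : ∀ i, Measurable fun z : ℝ × (BaseParams (I i) × Z i) =>
      ENNReal.ofReal (baseDensity C (I i) z.1 z.2.1) * q i z.2 := fun i =>
    (((measurable_baseDensity C (I i)).comp
      (f := fun z : ℝ × (BaseParams (I i) × Z i) => (z.1, z.2.1)) (by fun_prop)).ennreal_ofReal).mul
      ((hq i).comp measurable_snd)
  have hm' : ∀ phi i, Measurable fun z : BaseParams (I i) × Z i =>
      ENNReal.ofReal (baseDensity C (I i) phi z.1) * q i z := fun phi i =>
    (hm i).comp (f := fun z : BaseParams (I i) × Z i => (phi, z)) (by fun_prop)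
  have hmeas : Measurable fun w : ℝ × ((i : Fin n) → BaseParams (I i) × Z i) =>
      ENNReal.ofReal (precisionPrior w.1) *
        ∏ i, (.ofReal (baseDensity C (I i) w.1 (w.2 i).1) * q i (w.2 i)) := by
    refine Measurable.mul (by fun_prop) (Finset.measurable_fun_prod _ fun i _ => ?_)
    exact (hm i).comp (f := fun w : ℝ × ((i : Fin n) → BaseParams (I i) × Z i) => (w.1, w.2 i))
      (by fun_prop)
  have hi : ∀ phi i, 0 < phi → ∫⁻ z : BaseParams (I i) × Z i,
      ENNReal.ofReal (baseDensity C (I i) phi z.1) * q i z ≤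
        B i * .ofReal (min 1 √phi) ^ (5 / 8 : ℝ) := by
    intro phi i hphi
    rw [Measure.volume_eq_prod, lintegral_prod _ (hm' phi i).aemeasurable]
    refine le_trans (le_of_eq ?_) (hbound i phi hphi)
    refine lintegral_congr fun p => ?_
    have hqp : Measurable fun z => q i (p, z) :=
      (hq i).comp (f := fun z : Z i => (p, z)) (by fun_prop)
    dsimp only
    rw [lintegral_const_mul _ hqp, hqR]
  have hr : 1 < (5 / 8 : ℝ) * n := by
    have : (2 : ℝ) ≤ n := by exact_mod_cast hn
    linarith
  rw [Measure.volume_eq_prod, lintegral_prod _ hmeas.aemeasurable]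
  calc _ ≤ ∫⁻ phi, (∏ i, B i) *
        (.ofReal (precisionPrior phi) * .ofReal (min 1 √phi) ^ ((5 / 8 : ℝ) * n)) := by
        refine lintegral_mono fun phi => ?_
        have hpm : Measurable fun z : (i : Fin n) → BaseParams (I i) × Z i =>
            ∏ i, (ENNReal.ofReal (baseDensity C (I i) phi (z i).1) * q i (z i)) :=
          Finset.measurable_fun_prod _ fun i _ => (hm' phi i).comp (measurable_pi_apply i)
        dsimp only
        rw [lintegral_const_mul _ hpm, lintegral_fin_prod (hm' phi), mul_left_comm]
        by_cases hphi : 0 < phi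
        · gcongr
          calc _ ≤ ∏ i, (B i * ENNReal.ofReal (min 1 √phi) ^ (5 / 8 : ℝ)) :=
                Finset.prod_le_prod' fun i _ => hi phi i hphi
            _ = _ := by
              rw [Finset.prod_mul_distrib, Finset.prod_const, Finset.card_univ, Fintype.card_fin,
                ENNReal.rpow_mul, ENNReal.rpow_natCast]
        · simp [precisionPrior, hphi]
    _ = (∏ i, B i) * ∫⁻ phi,
        (.ofReal (precisionPrior phi) * .ofReal (min 1 √phi) ^ ((5 / 8 : ℝ) * n)) :=
        lintegral_const_mul _ (by fun_prop)
    _ < ∞ := ENNReal.mul_lt_top (ENNReal.prod_lt_top fun i _ => (hB i).lt_top)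
        (lintegral_precisionPrior_lt_top hr)

/-! ### Propriety from a finite integral and positivity on an open set -/

instance isOpenPosMeasure_volume_prod {α β : Type*} [MeasureSpace α] [MeasureSpace β]
    [TopologicalSpace α] [TopologicalSpace β] [SFinite (volume : Measure β)]
    [(volume : Measure α).IsOpenPosMeasure] [(volume : Measure β).IsOpenPosMeasure] :
    (volume : Measure (α × β)).IsOpenPosMeasure :=
  Measure.prod.instIsOpenPosMeasure

instance isOpenPosMeasure_volume_pi {ι : Type*} [Fintype ι] {α : ι → Type*}
    [∀ i, MeasureSpace (α i)] [∀ i, TopologicalSpace (α i)]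
    [∀ i, SigmaFinite (volume : Measure (α i))] [∀ i, (volume : Measure (α i)).IsOpenPosMeasure] :
    (volume : Measure (∀ i, α i)).IsOpenPosMeasure :=
  Measure.pi.isOpenPosMeasure _

/-- A nonnegative measurable density with finite integral which is positive on a nonempty open set
is proper. -/
theorem isProper_of_lintegral_lt_top {Ω : Type*} [MeasureSpace Ω] [TopologicalSpace Ω]
    [(volume : Measure Ω).IsOpenPosMeasure] {f : Ω → ℝ} (h0 : ∀ w, 0 ≤ f w) (hm : Measurable f)
    (hf : ∫⁻ w, .ofReal (f w) < ∞) {U : Set Ω} (hU : IsOpen U) (hne : U.Nonempty)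
    (hpos : ∀ w ∈ U, 0 < f w) : IsProper f := by
  have hint : Integrable f := by
    refine ⟨hm.aestronglyMeasurable, ?_⟩
    rwa [hasFiniteIntegral_iff_ofReal (Filter.Eventually.of_forall h0)]
  refine ⟨h0, hint, ?_⟩
  rw [integral_pos_iff_support_of_nonneg h0 hint]
  exact (hU.measure_pos _ hne).trans_le (measure_mono fun w hw => (hpos w hw).ne')

/-- The part of the posterior that involves the item difficulty deviations of one individual. -/
noncomputable def itemDensity (C : Constants) (I : Individual) (z : BaseParams I × ItemFamily I) :
    ℝ :=
  ∏ t, ∏ s, ∏ l, (normalDensity 0 (C.sigma ^ 2) (z.2 t s l) *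
    responseProb (I.X t s l) (predictor I z.1 t s + z.2 t s l))

/-- The part of the posterior that involves the latent variables of one individual. -/
noncomputable def augItemDensity (C : Constants) (I : Individual)
    (z : BaseParams I × ItemFamily I × ItemFamily I) : ℝ :=
  ∏ t, ∏ s, ∏ l, (ksDensity (z.2.2 t s l) * signIndicator (I.X t s l) (z.2.1 t s l) *
    normalDensity (predictor I z.1 t s) (4 * z.2.2 t s l ^ 2 + C.sigma ^ 2) (z.2.1 t s l))

theorem ofReal_prod_items {I : Individual}
    {f : (t : Fin I.T) → (s : Fin (I.S t)) → Fin (I.K t s) → ℝ} (hf : ∀ t s l, 0 ≤ f t s l) :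
    ENNReal.ofReal (∏ t, ∏ s, ∏ l, f t s l) = ∏ t, ∏ s, ∏ l, .ofReal (f t s l) := by
  rw [ENNReal.ofReal_prod_of_nonneg fun t _ => Finset.prod_nonneg fun s _ =>
    Finset.prod_nonneg fun l _ => hf t s l]
  refine Finset.prod_congr rfl fun t _ => ?_
  rw [ENNReal.ofReal_prod_of_nonneg fun s _ => Finset.prod_nonneg fun l _ => hf t s l]
  refine Finset.prod_congr rfl fun s _ => ?_
  rw [ENNReal.ofReal_prod_of_nonneg fun l _ => hf t s l]

theorem itemDensity_pos {C : Constants} (hsigma : 0 < C.sigma) (I : Individual)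
    (z : BaseParams I × ItemFamily I) : 0 < itemDensity C I z :=
  Finset.prod_pos fun _ _ => Finset.prod_pos fun _ _ => Finset.prod_pos fun _ _ =>
    mul_pos (normalDensity_pos (by positivity) _ _) (responseProb_pos _ _)

theorem augItemDensity_nonneg (C : Constants) (I : Individual)
    (z : BaseParams I × ItemFamily I × ItemFamily I) : 0 ≤ augItemDensity C I z :=
  Finset.prod_nonneg fun _ _ => Finset.prod_nonneg fun _ _ => Finset.prod_nonneg fun _ _ =>
    mul_nonneg (mul_nonneg (ksDensity_nonneg _) (signIndicator_nonneg _ _))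
      (normalDensity_nonneg _ _ _)

theorem measurable_itemDensity (C : Constants) (I : Individual) :
    Measurable (itemDensity C I) := by
  unfold itemDensity
  refine Finset.measurable_fun_prod _ fun t _ => Finset.measurable_fun_prod _ fun s _ =>
    Finset.measurable_fun_prod _ fun l _ => ?_
  have := measurable_predictor I t s
  fun_prop

theorem measurable_augItemDensity (C : Constants) (I : Individual) :
    Measurable (augItemDensity C I) := by
  unfold augItemDensity
  refine Finset.measurable_fun_prod _ fun t _ => Finset.measurable_fun_prod _ fun s _ =>
    Finset.measurable_fun_prod _ fun l _ => ?_
  have := measurable_predictor I t s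
  fun_prop

theorem lintegral_itemDensity {C : Constants} (I : Individual) (p : BaseParams I) :
    ∫⁻ z, .ofReal (itemDensity C I (p, z)) = responseLikelihood (responseMean C) I p := by
  unfold responseLikelihood responseMean
  rw [← lintegral_itemFamily_prod I (f := fun t s l e => ENNReal.ofReal
    (normalDensity 0 (C.sigma ^ 2) e * responseProb (I.X t s l) (predictor I p t s + e)))
    fun t s l => by fun_prop]
  exact lintegral_congr fun z => ofReal_prod_items fun t s l =>
    mul_nonneg (normalDensity_nonneg _ _ _) (responseProb_pos _ _).le

theorem lintegral_augItemDensity (C : Constants) (I : Individual) (p : BaseParams I) :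
    ∫⁻ z, .ofReal (augItemDensity C I (p, z)) = responseLikelihood (augResponseMean C) I p := by
  have hm : Measurable fun z : ItemFamily I × ItemFamily I =>
      ENNReal.ofReal (augItemDensity C I (p, z)) :=
    ((measurable_augItemDensity C I).comp
      (f := fun z : ItemFamily I × ItemFamily I => (p, z)) (by fun_prop)).ennreal_ofReal
  have hm2 : ∀ t s l, Measurable fun nu : ℝ => ∫⁻ y, ENNReal.ofReal (ksDensity nu *
      signIndicator (I.X t s l) y *
      normalDensity (predictor I p t s) (4 * nu ^ 2 + C.sigma ^ 2) y) := fun t s l =>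
    Measurable.lintegral_prod_right' (ν := volume) (f := fun z : ℝ × ℝ =>
      ENNReal.ofReal (ksDensity z.1 * signIndicator (I.X t s l) z.2 *
      normalDensity (predictor I p t s) (4 * z.1 ^ 2 + C.sigma ^ 2) z.2)) (by fun_prop)
  -- `Y` is integrated before `ν`, matching the order in `augResponseMean`.
  rw [Measure.volume_eq_prod, lintegral_prod_symm' _ hm]
  unfold responseLikelihood augResponseMean
  rw [← lintegral_itemFamily_prod I hm2]
  refine lintegral_congr fun nu => ?_
  rw [← lintegral_itemFamily_prod I (f := fun t s l y => ENNReal.ofReal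
    (ksDensity (nu t s l) * signIndicator (I.X t s l) y *
      normalDensity (predictor I p t s) (4 * nu t s l ^ 2 + C.sigma ^ 2) y))
    fun t s l => by fun_prop]
  exact lintegral_congr fun y => ofReal_prod_items fun t s l =>
    mul_nonneg (mul_nonneg (ksDensity_nonneg _) (signIndicator_nonneg _ _))
      (normalDensity_nonneg _ _ _)

-- Treats both forms at once: `q` is the item part of the density, `Z` its variables, and `U` an
-- open set of them on which it is positive whatever the base parameters.
set_option synthInstance.maxHeartbeats 400000 in
set_option synthInstance.maxSize 2000 in
theorem ResponseBound.isProper {R : Bool → ℝ → ℝ≥0∞} {K : ℝ≥0∞}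
    (hR : ResponseBound R K) {n : ℕ} (hn : 2 ≤ n) {C : Constants} {I : Fin n → Individual}
    (hrho : C.rho ≠ 0) (hmax : 0 < C.maxLapse) (hlapse : ∀ i t, 0 < (I i).lapse t)
    (hV : ∀ i, 0 < (I i).V)
    (hdays : ∀ i, ∃ t t', t ≠ t' ∧ (I i).InformativeDay t ∧ (I i).InformativeDay t')
    {Z : Fin n → Type} [∀ i, MeasureSpace (Z i)] [∀ i, SigmaFinite (volume : Measure (Z i))]
    [∀ i, TopologicalSpace (Z i)] [∀ i, (volume : Measure (Z i)).IsOpenPosMeasure]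
    {q : ∀ i, BaseParams (I i) × Z i → ℝ} (hq : ∀ i, Measurable (q i)) (hq0 : ∀ i z, 0 ≤ q i z)
    (hqR : ∀ i p, ∫⁻ z, .ofReal (q i (p, z)) = responseLikelihood R (I i) p)
    {U : ∀ i, Set (Z i)} (hU : ∀ i, IsOpen (U i)) (hne : ∀ i, (U i).Nonempty)
    (hpos : ∀ i p, ∀ z ∈ U i, 0 < q i (p, z)) :
    IsProper fun w : ℝ × ((i : Fin n) → BaseParams (I i) × Z i) => precisionPrior w.1 *
      ∏ i, (baseDensity C (I i) w.1 (w.2 i).1 * q i (w.2 i)) := by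
  have hbq : ∀ phi i z, 0 ≤ baseDensity C (I i) phi z.1 * q i z := fun phi i z =>
    mul_nonneg (baseDensity_nonneg _ _ _ _) (hq0 i z)
  refine isProper_of_lintegral_lt_top (U := {w | 0 < w.1} ∩ ⋂ i, ({w | 0 < (w.2 i).1.2.1} ∩
    {w | 0 < (w.2 i).1.2.2.1} ∩ {w | 0 < (w.2 i).1.2.2.2.1} ∩ (fun w => (w.2 i).2) ⁻¹' U i))
    ?_ ?_ ?_ ?_ ?_ ?_
  · exact fun w => mul_nonneg (precisionPrior_nonneg _) (Finset.prod_nonneg fun i _ => hbq _ i _)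
  · refine Measurable.mul (by fun_prop) (Finset.measurable_fun_prod _ fun i _ =>
      Measurable.mul ?_ ?_)
    · exact (measurable_baseDensity C (I i)).comp
        (f := fun w : ℝ × ((i : Fin n) → BaseParams (I i) × Z i) => (w.1, (w.2 i).1))
        (by fun_prop)
    · exact (hq i).comp (f := fun w : ℝ × ((i : Fin n) → BaseParams (I i) × Z i) => w.2 i)
        (by fun_prop)
  · refine lt_of_eq_of_lt (lintegral_congr fun w => ?_)
      (hR.lintegral_joint_lt_top hn C I hrho hmax hlapse hV hdays (q := fun i z => .ofReal (q i z))
      (fun i => (hq i).ennreal_ofReal) hqR)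
    rw [ENNReal.ofReal_mul (precisionPrior_nonneg _),
      ENNReal.ofReal_prod_of_nonneg fun i _ => hbq _ i _]
    simp only [ENNReal.ofReal_mul (baseDensity_nonneg _ _ _ _)]
  · refine (isOpen_lt (by fun_prop) (by fun_prop)).inter (isOpen_iInter_of_finite fun i => ?_)
    exact (((isOpen_lt (by fun_prop) (by fun_prop)).inter (isOpen_lt (by fun_prop)
      (by fun_prop))).inter (isOpen_lt (by fun_prop) (by fun_prop))).inter
      ((hU i).preimage (by fun_prop))
  · choose z hz using hne
    exact ⟨(1, fun i => ((0, 1, 1, 1, 0, 0), z i)), by simpa using hz⟩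
  · intro w hw
    simp only [Set.mem_inter_iff, Set.mem_iInter, Set.mem_ofPred_eq, Set.mem_preimage] at hw
    obtain ⟨h1, h2⟩ := hw
    refine mul_pos ?_ (Finset.prod_pos fun i _ => ?_)
    · rw [precisionPrior, if_pos h1]
      exact Real.rpow_pos_of_pos h1 _
    · obtain ⟨⟨⟨hc, hδ⟩, hτ⟩, hz⟩ := h2 i
      exact mul_pos (baseDensity_pos (hlapse i) (hV i) h1 hc hδ hτ) (hpos i _ _ hz)

section proper

variable {n : ℕ} {C : Constants} {I : Fin n → Individual}

set_option synthInstance.maxHeartbeats 400000 in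
set_option synthInstance.maxSize 2000 in
theorem isProper_posterior (hn : 2 ≤ n) (hrho : C.rho ≠ 0) (hsigma : 0 < C.sigma)
    (hmax : 0 < C.maxLapse) (hlapse : ∀ i t, 0 < (I i).lapse t) (hV : ∀ i, 0 < (I i).V)
    (hdays : ∀ i, ∃ t t', t ≠ t' ∧ (I i).InformativeDay t ∧ (I i).InformativeDay t') :
    IsProper (posterior C I) :=
  (responseBound_responseMean C hsigma).isProper hn hrho hmax hlapse hV hdays
    (Z := fun i => ItemFamily (I i)) (q := fun i => itemDensity C (I i)) (U := fun _ => Set.univ)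
    (fun i => measurable_itemDensity C (I i)) (fun i z => (itemDensity_pos hsigma (I i) z).le)
    (fun i p => lintegral_itemDensity (I i) p) (fun _ => isOpen_univ) (fun _ => ⟨0, trivial⟩)
    (fun i p z _ => itemDensity_pos hsigma (I i) (p, z))

set_option synthInstance.maxHeartbeats 400000 in
set_option synthInstance.maxSize 2000 in
theorem isProper_augPosterior (hn : 2 ≤ n) (hrho : C.rho ≠ 0) (hsigma : 0 < C.sigma)
    (hmax : 0 < C.maxLapse) (hlapse : ∀ i t, 0 < (I i).lapse t) (hV : ∀ i, 0 < (I i).V)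
    (hdays : ∀ i, ∃ t t', t ≠ t' ∧ (I i).InformativeDay t ∧ (I i).InformativeDay t') :
    IsProper (augPosterior C I) := by
  refine (responseBound_augResponseMean C hsigma).isProper hn hrho hmax hlapse hV hdays
    (Z := fun i => ItemFamily (I i) × ItemFamily (I i)) (q := fun i => augItemDensity C (I i))
    -- For `ν > 1` the alternating series gives strict positivity, and strict signs of `Y` matching
    -- the responses keep the set open.
    (U := fun i => ⋂ t, ⋂ s, ⋂ l, {z | 1 < z.2 t s l} ∩
      {z | 0 < (if (I i).X t s l then 1 else -1) * z.1 t s l})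
    (fun i => measurable_augItemDensity C (I i)) (fun i z => augItemDensity_nonneg C (I i) z)
    (fun i p => lintegral_augItemDensity C (I i) p) (fun i => ?_) (fun i => ?_) (fun i p z hz => ?_)
  · exact isOpen_iInter_of_finite fun t => isOpen_iInter_of_finite fun s =>
      isOpen_iInter_of_finite fun l => (isOpen_lt (by fun_prop) (by fun_prop)).inter
      (isOpen_lt (by fun_prop) (by fun_prop))
  · refine ⟨(fun t s l => if (I i).X t s l then 1 else -1, fun _ _ _ => 2), ?_⟩
    simp only [Set.mem_iInter, Set.mem_inter_iff, Set.mem_ofPred_eq]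
    refine fun t s l => ⟨one_lt_two, ?_⟩
    split_ifs <;> norm_num
  · simp only [Set.mem_iInter, Set.mem_inter_iff, Set.mem_ofPred_eq] at hz
    refine Finset.prod_pos fun t _ => Finset.prod_pos fun s _ => Finset.prod_pos fun l _ => ?_
    obtain ⟨h3, h4⟩ := hz t s l
    refine mul_pos (mul_pos (ksDensity_pos_of_one_le h3.le) ?_)
      (normalDensity_pos (by positivity) _ _)
    unfold signIndicator
    rcases hX : (I i).X t s l with _ | _
    · simp only [hX, Bool.false_eq_true, if_false] at h4
      have : z.1 t s l ≤ 0 := by linarith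
      simp [this]
    · simp only [hX, if_true] at h4
      have : 0 < z.1 t s l := by linarith
      simp [this]

end proper

end DIR

theorem mainTheorem1 (n : ℕ) (hn : 2 ≤ n) (C : DIR.Constants) (I : Fin n → DIR.Individual)
    (hrho : C.rho ≠ 0) (hsigma : 0 < C.sigma) (hmax : 0 < C.maxLapse)
    (hlapse : ∀ i t, 0 < (I i).lapse t) (hV : ∀ i, 0 < (I i).V)
    (hT : ∀ i, 2 ≤ (I i).T)
    (hdays : ∀ i, ∃ t t', t ≠ t' ∧ (I i).InformativeDay t ∧ (I i).InformativeDay t') :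
    DIR.IsProper (DIR.posterior C I) ∧ DIR.IsProper (DIR.augPosterior C I) :=
  ⟨DIR.isProper_posterior hn hrho hsigma hmax hlapse hV hdays,
    DIR.isProper_augPosterior hn hrho hsigma hmax hlapse hV hdays⟩
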